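/- **Setting.** Let $\mathbb F$ be an algebraically closed field and let $\mathcal C$ be an $\mathbb F$-linear abelian tensor (monoidal) category with $\mathbb F$-bilinear tensor product, finite-dimensional Hom-spaces and simple unit object $\mathbf 1$. Assume that $\mathcal C$ is Krull–Schmidt (every object is a finite direct sum of indecomposable objects, uniquely up to isomorphism and permutation of the summands) and has only finitely many indecomposable objects up to isomorphism, with representatives $V_0=\mathbf 1,V_1,\dots,V_n$; put $I=\{0,\dots,n\}$. If $\mathcal C$ is strict, the constraints $\alpha,\lambda,\rho$ of $\mathcal C$ below are identities; strictness is not needed. **The data of $\mathcal C$.** * The *Green ring* $r(\mathcal C)$ is the abelian group generated by the isomorphism classes $[M]$ of objects modulo $[M\oplus N]=[M]+[N]$, with product $[M][N]=[M\otimes N]$. The $[V_i]$ form a $\mathbb Z$-basis with $[V_0]=1$ and $[V_i][V_j]=\sum_k c_{ijk}[V_k]$, $c_{ijk}\in\mathbb N$; put $\mathbf c_{ij}=(c_{ijk})_k\in\mathbb N^I$. * The *Auslander algebra* is $A=A(\mathcal C)=\operatorname{End}(V)$, $V=\bigoplus_i V_i$, with projections $\pi_i$, inclusions $\tau_i$ and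 idempotents $e_i=\tau_i\pi_i$. For $\mathbf m,\mathbf s\in\mathbb N^I$, an $(\mathbf s,\mathbf m)$-type matrix is a block matrix whose $(i,j)$ block is an $s_i\times m_j$ matrix over $e_iAe_j$; $E_{\mathbf m}$ denotes the identity matrix. With $V^{(\mathbf m)}=\bigoplus_i m_iV_i$, the morphisms $V^{(\mathbf m)}\to V^{(\mathbf s)}$ are identified with these matrices. Let $X^{\mathbf m}_p$, $Y^{\mathbf m}_p$ be the column and the row having $e_i$ in position $p$ (in block $i$) and $0$ elsewhere; these are the insertions of and projections to the summands. Let $\mathbf e_i\in\mathbb N^I$ be the $i$-th unit vector. * Choose isomorphisms $\theta_{ij}:V_i\otimes V_j\to V^{(\mathbf c_{ij})}$ such that $\theta_{0i}$ and $\theta_{i0}$ are the identity of $V_i$ (that is, the unit constraints $\lambda_{V_i}$ and $\rho_{V_i}$). Let $M(\mathcal C)$ be the direct sum, over all $(i,j),(i',j')\in I\times I$, of the spaces of $(\mathbf c_{i'j'},\mathbf c_{ij})$-type matrices, with blockwise matrix multiplication. The algebra map $\varphi:A\otimes_{\mathbb F}A\to M(\mathcal C)$ sends $x\otimes y$ to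 the element whose component from $(i,j)$ to $(i',j')$ is the matrix of $\theta_{i'j'}(\pi_{i'}\otimes\pi_{j'})(x\otimes y)(\tau_i\otimes\tau_j)\theta_{ij}^{-1}$. * For $\mathbf m,\mathbf s\in\mathbb N^I$ let $\mathbf m\mathbin{\widehat\otimes}\mathbf s=\sum_{i,j}m_is_j\mathbf c_{ij}$. For typed matrices $X,Y$, the matrix $X\mathbin{\widehat\otimes}Y$ is obtained from the matrices $\varphi(x_{pp'}\otimes y_{qq'})$, for rows $p,q$ and columns $p',q'$ of $X,Y$, by concatenation: for each $k$, the rows (columns) of type $k$ of all these matrices are collected into block $k$, in the lexicographic order of (row $q$ of $Y$, row $p$ of $X$, row of the inserted matrix), and similarly for columns. * Let $\theta(\mathbf m,\mathbf s)=\sum_{p,q}(X^{\mathbf m}_p\mathbin{\widehat\otimes}X^{\mathbf s}_q)\,\theta_{ij}\,(Y^{\mathbf m}_p\otimes Y^{\mathbf s}_q):V^{(\mathbf m)}\otimes V^{(\mathbf s)}\to V^{(\mathbf m\widehat\otimes\mathbf s)}$, where $i,j$ are the blocks of $p,q$; these are isomorphisms. Let $a=\{a_{ijl}\}$ be the invertible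 matrices $$a_{ijl}=\theta(\mathbf e_i,\mathbf e_j\mathbin{\widehat\otimes}\mathbf e_l)\,(E\otimes\theta(\mathbf e_j,\mathbf e_l))\,\alpha\,(\theta(\mathbf e_i,\mathbf e_j)^{-1}\otimes E)\,\theta(\mathbf e_i\mathbin{\widehat\otimes}\mathbf e_j,\mathbf e_l)^{-1},$$ where $\alpha$ is the associativity constraint of $\mathcal C$. **The category $\widehat{\mathcal C}$** built from $(r(\mathcal C),A(\mathcal C),\varphi,a)$: its objects are the elements of $\mathbb N^I$, the morphisms $\mathbf m\to\mathbf s$ are the $(\mathbf s,\mathbf m)$-type matrices over $A$, and composition is the matrix product. Its tensor product is $\widehat\otimes$, its unit object is $\mathbf e_0$, its unit constraints are identities, and its associativity constraint is $$a_{\mathbf m,\mathbf s,\mathbf t}=\sum_{p,q,r}\bigl(X^{\mathbf m}_p\mathbin{\widehat\otimes}(X^{\mathbf s}_q\mathbin{\widehat\otimes}X^{\mathbf t}_r)\bigr)\,a_{ijl}\,\bigl((Y^{\mathbf m}_p\mathbin{\widehat\otimes}Y^{\mathbf s}_q)\mathbin{\widehat\otimes}Y^{\mathbf t}_r\bigr),$$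 where $i,j,l$ are the blocks of $p,q,r$. **Theorem.** Isomorphisms $\theta_{ij}$ as above exist, and for every choice of them: 1. $\widehat{\mathcal C}$, with this structure, is a tensor category, and it is tensor equivalent to $\mathcal C$: there is an $\mathbb F$-linear strong monoidal functor $\widehat{\mathcal C}\to\mathcal C$ that is an equivalence of categories. 2. $\mathcal C$ is determined up to tensor equivalence by the quadruple $(r(\mathcal C),A(\mathcal C),\varphi,a)$: let $\mathcal C'$ be another category satisfying the same hypotheses, with representatives $V'_0=\mathbf 1,\dots,V'_n$ and isomorphisms $\theta'_{ij}$, and suppose that there are a ring isomorphism $r(\mathcal C)\to r(\mathcal C')$ with $[V_i]\mapsto[V'_i]$ for all $i$ and an $\mathbb F$-algebra isomorphism $\delta:A(\mathcal C)\to A(\mathcal C')$ with $\delta(e_i)=e'_i$ for all $i$ which, applied to matrix entries, carries $\varphi$ to $\varphi'$ (that is, $\delta(\varphi(z))=\varphi'((\delta\otimes\delta)(z))$ for all $z$) and $a_{ijl}$ to $a'_{ijl}$ for all $i,j,l$. Then $\mathcal C$ and $\mathcal C'$ are tensor equivalent. -/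

import Mathlib

open CategoryTheory CategoryTheory.Limits CategoryTheory.MonoidalCategory
open scoped TensorProduct

universe u v u' v'

set_option linter.unusedSectionVars false

noncomputable section

/-! ### Typed matrices and the category `Ĉ` -/

namespace TensorRecon

/-- The rows (or columns) of a matrix of type `m = (m₀, …, mₙ)`: the `k`-th row in the `i`-th
block, `k < mᵢ`.  For `m = 0` there are none. -/
abbrev Idx {n : ℕ} (m : Fin (n + 1) → ℕ) : Type := Σ i : Fin (n + 1), Fin (m i)

/-- An algebra `A` with a finite complete family of orthogonal idempotents `e₀, …, eₙ`. -/
structure IdemFamily (𝕜 A : Type*) [Field 𝕜] [Ring A] [Algebra 𝕜 A] (n : ℕ) where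
  e : Fin (n + 1) → A
  complete : CompleteOrthogonalIdempotents e

section Hat

variable {𝕜 A : Type*} [Field 𝕜] [Ring A] [Algebra 𝕜 A] {n : ℕ}

theorem IdemFamily.e_mul_e (E : IdemFamily 𝕜 A n) (i : Fin (n + 1)) : E.e i * E.e i = E.e i :=
  E.complete.idem i

/-- The `(s, m)`-type matrices over `A`: block matrices whose `(i, j)` block has size `sᵢ × mⱼ`
and entries in `eᵢ A eⱼ`. -/
def typedMatrix (E : IdemFamily 𝕜 A n) (s m : Fin (n + 1) → ℕ) :
    Submodule 𝕜 (Matrix (Idx s) (Idx m) A) where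
  carrier := {X | ∀ p q, E.e p.1 * X p q * E.e q.1 = X p q}
  add_mem' {X Y} hX hY p q := by
    simp only [Matrix.add_apply, mul_add, add_mul, hX p q, hY p q]
  zero_mem' p q := by simp
  smul_mem' a X hX p q := by
    simp only [Matrix.smul_apply, mul_smul_comm, smul_mul_assoc, hX p q]

theorem typedMatrix_left {E : IdemFamily 𝕜 A n} {s m : Fin (n + 1) → ℕ}
    (X : typedMatrix E s m) (p : Idx s) (q : Idx m) : E.e p.1 * X.1 p q = X.1 p q := by
  rw [← X.2 p q, ← mul_assoc, ← mul_assoc, E.e_mul_e]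

theorem typedMatrix_right {E : IdemFamily 𝕜 A n} {s m : Fin (n + 1) → ℕ}
    (X : typedMatrix E s m) (p : Idx s) (q : Idx m) : X.1 p q * E.e q.1 = X.1 p q := by
  rw [← X.2 p q, mul_assoc, E.e_mul_e]

/-- The objects of `Ĉ`: elements of `ℕ^I`, `I = {0, …, n}`. -/
@[ext]
structure Hat (E : IdemFamily 𝕜 A n) where
  mult : Fin (n + 1) → ℕ

/-- The category `Ĉ`: a morphism `m ⟶ s` is an `(s, m)`-type matrix over `A`, and composition is
the matrix product (`f ≫ g` is the product `g f`). The identity is `E_m = diag(e_i)`. -/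
instance Hat.category (E : IdemFamily 𝕜 A n) : Category (Hat E) where
  Hom m s := typedMatrix E s.mult m.mult
  id m := ⟨Matrix.diagonal fun p => E.e p.1, fun p q => by
    by_cases h : p = q
    · subst h; simp [E.e_mul_e]
    · simp [Matrix.diagonal_apply_ne _ h]⟩
  comp {m s t} f g := ⟨g.1 * f.1, fun p q => by
    simp only [Matrix.mul_apply, Finset.mul_sum, Finset.sum_mul]
    refine Finset.sum_congr rfl fun r _ => ?_
    rw [← mul_assoc, typedMatrix_left, mul_assoc, typedMatrix_right]⟩
  id_comp {m s} f := by
    apply Subtype.ext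
    ext p q
    simp only [Matrix.mul_diagonal]
    exact typedMatrix_right f p q
  comp_id {m s} f := by
    apply Subtype.ext
    ext p q
    simp only [Matrix.diagonal_mul]
    exact typedMatrix_left f p q
  assoc f g h := Subtype.ext (Matrix.mul_assoc _ _ _).symm

variable {E : IdemFamily 𝕜 A n}

/-- The matrix underlying a morphism of `Ĉ`. -/
def Hat.mat {m s : Hat E} (f : m ⟶ s) : Matrix (Idx s.mult) (Idx m.mult) A := Subtype.val f

theorem Hat.hom_ext {m s : Hat E} {f g : m ⟶ s} (h : ∀ p q, Hat.mat f p q = Hat.mat g p q) :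
    f = g := Subtype.ext (Matrix.ext h)

theorem Hat.mat_comp {m s t : Hat E} (f : m ⟶ s) (g : s ⟶ t) :
    Hat.mat (f ≫ g) = Hat.mat g * Hat.mat f := rfl

theorem Hat.mat_id (m : Hat E) : Hat.mat (𝟙 m) = Matrix.diagonal fun p => E.e p.1 := rfl

theorem Hat.left_mat {m s : Hat E} (f : m ⟶ s) (p : Idx s.mult) (q : Idx m.mult) :
    E.e p.1 * Hat.mat f p q = Hat.mat f p q := typedMatrix_left f p q

theorem Hat.mat_right {m s : Hat E} (f : m ⟶ s) (p : Idx s.mult) (q : Idx m.mult) :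
    Hat.mat f p q * E.e q.1 = Hat.mat f p q := typedMatrix_right f p q

instance (m s : Hat E) : AddCommGroup (m ⟶ s) :=
  inferInstanceAs (AddCommGroup (typedMatrix E s.mult m.mult))

instance (m s : Hat E) : Module 𝕜 (m ⟶ s) :=
  inferInstanceAs (Module 𝕜 (typedMatrix E s.mult m.mult))

@[simp] theorem Hat.mat_add {m s : Hat E} (f g : m ⟶ s) :
    Hat.mat (f + g) = Hat.mat f + Hat.mat g := rfl

@[simp] theorem Hat.mat_zero (m s : Hat E) : Hat.mat (0 : m ⟶ s) = 0 := rfl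

@[simp] theorem Hat.mat_smul {m s : Hat E} (a : 𝕜) (f : m ⟶ s) :
    Hat.mat (a • f) = a • Hat.mat f := rfl

/-- `mat` as an additive map. -/
def Hat.matHom (m s : Hat E) : (m ⟶ s) →+ Matrix (Idx s.mult) (Idx m.mult) A where
  toFun := Hat.mat
  map_zero' := rfl
  map_add' _ _ := rfl

theorem Hat.mat_sum {ι : Type*} {m s : Hat E} (t : Finset ι) (f : ι → (m ⟶ s)) :
    Hat.mat (∑ i ∈ t, f i) = ∑ i ∈ t, Hat.mat (f i) := map_sum (Hat.matHom m s) f t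

instance : Preadditive (Hat E) where
  add_comp _ _ _ f f' g := Subtype.ext (Matrix.mul_add _ _ _)
  comp_add _ _ _ f g g' := Subtype.ext (Matrix.add_mul _ _ _)

instance : Linear 𝕜 (Hat E) where
  smul_comp _ _ _ a f g := Subtype.ext (Matrix.mul_smul _ a _)
  comp_smul _ _ _ f a g := Subtype.ext (Matrix.smul_mul a _ _)

end Hat

/-! ### The algebra `M(R, A, I)` -/

section MatLinear

variable {𝕜 : Type*} [Field 𝕜] {D : Type*} [Category D] [Preadditive D] [Linear 𝕜 D]

instance (M N : Mat_ D) : Module 𝕜 (M ⟶ N) :=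
  inferInstanceAs (Module 𝕜 (∀ (i : M.ι) (j : N.ι), M.X i ⟶ N.X j))

theorem mat_smul_apply {M N : Mat_ D} (a : 𝕜) (f : M ⟶ N) (i : M.ι) (j : N.ι) :
    (a • f) i j = a • f i j := rfl

instance : Linear 𝕜 (Mat_ D) where
  smul_comp M N K a f g := by
    ext i k
    simp only [Mat_.comp_apply, mat_smul_apply, Linear.smul_comp, Finset.smul_sum]
  comp_smul M N K f a g := by
    ext i k
    simp only [Mat_.comp_apply, mat_smul_apply, Linear.comp_smul, Finset.smul_sum]

end MatLinear

/-! ### Structure constants and the positions in a concatenation -/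

section Fusion

variable {n : ℕ}

/-- A `ℤ₊`-ring with a finite unital `ℤ₊`-basis `r₀ = 1, r₁, …, rₙ`: the products `rᵢ rⱼ` are
combinations of the `r_k` with nonnegative coefficients. -/
structure ZPlusBasis (R : Type*) [Ring R] (n : ℕ) where
  basis : Module.Basis (Fin (n + 1)) ℤ R
  nonneg : ∀ i j k, 0 ≤ basis.repr (basis i * basis j) k
  unital : basis 0 = 1

/-- The structure constants: `rᵢ rⱼ = ∑ₖ c i j k • rₖ`, `c i j k ∈ ℕ`. -/
def ZPlusBasis.c {R : Type*} [Ring R] (r : ZPlusBasis R n) (i j k : Fin (n + 1)) : ℕ :=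
  (r.basis.repr (r.basis i * r.basis j) k).toNat

theorem ZPlusBasis.mul_eq {R : Type*} [Ring R] (r : ZPlusBasis R n) (i j : Fin (n + 1)) :
    r.basis i * r.basis j = ∑ k, (r.c i j k : ℤ) • r.basis k := by
  conv_lhs => rw [← r.basis.sum_repr (r.basis i * r.basis j)]
  refine Finset.sum_congr rfl fun k _ => ?_
  rw [ZPlusBasis.c, Int.toNat_of_nonneg (r.nonneg i j k)]

/-- The vector `e_i = (δ_{ij})_j` of `ℕ^I`. -/
abbrev unitVec (i : Fin (n + 1)) : Fin (n + 1) → ℕ := Pi.single i 1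

theorem ZPlusBasis.c_zero_left {R : Type*} [Ring R] (r : ZPlusBasis R n) (i : Fin (n + 1)) :
    r.c 0 i = unitVec i := by
  funext k
  rw [ZPlusBasis.c, r.unital, one_mul, r.basis.repr_self, Finsupp.single_apply]
  by_cases h : i = k
  · subst h; simp
  · simp [h, Ne.symm h]

theorem ZPlusBasis.c_zero_right {R : Type*} [Ring R] (r : ZPlusBasis R n) (i : Fin (n + 1)) :
    r.c i 0 = unitVec i := by
  funext k
  rw [ZPlusBasis.c, r.unital, mul_one, r.basis.repr_self, Finsupp.single_apply]
  by_cases h : i = k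
  · subst h; simp
  · simp [h, Ne.symm h]

/-- The product `m ⊗̂ s = ∑_{i,j} mᵢ sⱼ c_{ij}` of elements of `ℕ^I`. -/
def tens (c : Fin (n + 1) → Fin (n + 1) → Fin (n + 1) → ℕ) (m s : Fin (n + 1) → ℕ) :
    Fin (n + 1) → ℕ := fun k => ∑ i, ∑ j, m i * s j * c i j k

theorem tens_unit_unit (c : Fin (n + 1) → Fin (n + 1) → Fin (n + 1) → ℕ) (i j : Fin (n + 1)) :
    tens c (unitVec i) (unitVec j) = c i j := by
  funext k
  simp [tens, Pi.single_apply]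

theorem ZPlusBasis.tens_zero_left {R : Type*} [Ring R] (r : ZPlusBasis R n)
    (m : Fin (n + 1) → ℕ) : tens r.c (unitVec 0) m = m := by
  funext k
  simp [tens, Pi.single_apply, r.c_zero_left]

theorem ZPlusBasis.tens_zero_right {R : Type*} [Ring R] (r : ZPlusBasis R n)
    (m : Fin (n + 1) → ℕ) : tens r.c m (unitVec 0) = m := by
  funext k
  simp [tens, Pi.single_apply, r.c_zero_right]

variable (c : Fin (n + 1) → Fin (n + 1) → Fin (n + 1) → ℕ) (m s : Fin (n + 1) → ℕ)

/-- The positions in the `k`-th block of the concatenation of the `c_{ij}`, one for each pair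
formed of the `a`-th row `p` of block `i` of an `m`-type and the `b`-th row `q` of block `j` of an
`s`-type matrix. The rows of `X ⊗ Y` are ordered with `q = (j, b)` as the major and `p = (i, a)` as
the minor index, and concatenation keeps, inside block `k`, the order of the summands: so the
order is the lexicographic order of `(j, b, i, a, t)`, `t < c_{ijk}`. -/
abbrev Pos (k : Fin (n + 1)) : Type :=
  Σₗ (j : Fin (n + 1)), Σₗ (_ : Fin (s j)), Σₗ (i : Fin (n + 1)), Σₗ (_ : Fin (m i)), Fin (c i j k)

theorem card_pos (k : Fin (n + 1)) : Fintype.card (Pos c m s k) = tens c m s k := by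
  simp only [Pos, Fintype.card_lex, Fintype.card_sigma, Fintype.card_fin, Finset.sum_const,
    Finset.card_univ, smul_eq_mul, tens]
  rw [Finset.sum_comm]
  refine Finset.sum_congr rfl fun j _ => ?_
  rw [Finset.mul_sum]
  refine Finset.sum_congr rfl fun i _ => ?_
  ring

/-- The increasing enumeration of the positions in block `k`. -/
def posEquiv (k : Fin (n + 1)) : Fin (tens c m s k) ≃o Pos c m s k :=
  monoEquivOfFin _ (card_pos c m s k)

variable {c m s} in
/-- The pair of rows `(p, q)` and the row of type `c_{ij}` belonging to a position. -/
def Pos.unpack {k : Fin (n + 1)} (w : Pos c m s k) : Σ x : Idx m × Idx s, Idx (c x.1.1 x.2.1) :=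
  let w1 := ofLex (ofLex w).2
  let w2 := ofLex w1.2
  let w3 := ofLex w2.2
  ⟨(⟨w2.1, w3.1⟩, ⟨(ofLex w).1, w1.1⟩), ⟨k, w3.2⟩⟩

variable {c m s} in
/-- The position with given data. -/
def Pos.pack (x : Σ x : Idx m × Idx s, Idx (c x.1.1 x.2.1)) : Pos c m s x.2.1 :=
  toLex ⟨x.1.2.1, toLex ⟨x.1.2.2, toLex ⟨x.1.1.1, toLex ⟨x.1.1.2, x.2.2⟩⟩⟩⟩

/-- The permutation underlying the concatenation `Π` of the blocks of a matrix indexed by pairs of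
rows: it identifies the rows of type `m ⊗̂ s` with the disjoint union, over all pairs `(p, q)`, of
the rows of type `c_{ij}`, where `p` is in block `i` and `q` is in block `j`. -/
def splitIdx : Idx (tens c m s) ≃ Σ x : Idx m × Idx s, Idx (c x.1.1 x.2.1) where
  toFun P := Pos.unpack (posEquiv c m s P.1 P.2)
  invFun x := ⟨x.2.1, (posEquiv c m s x.2.1).symm (Pos.pack x)⟩
  left_inv P := by
    obtain ⟨k, u⟩ := P
    exact Sigma.ext rfl (heq_of_eq ((posEquiv c m s k).symm_apply_apply u))
  right_inv x := by
    change Pos.unpack (posEquiv c m s x.2.1 ((posEquiv c m s x.2.1).symm (Pos.pack x))) = x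
    rw [OrderIso.apply_symm_apply]
    rfl

end Fusion

/-! ### The algebra map `φ` and the tensor product of morphisms -/

section Tensor

variable {𝕜 A : Type*} [Field 𝕜] [Ring A] [Algebra 𝕜 A] {n : ℕ}
  (E : IdemFamily 𝕜 A n) (c : Fin (n + 1) → Fin (n + 1) → Fin (n + 1) → ℕ)

variable {E} in
/-- The object `m ⊗̂ s` of `Ĉ`. -/
def Hat.tensor (m s : Hat E) : Hat E := ⟨tens c m.mult s.mult⟩

/-- The object `e_i` of `Ĉ`. -/
abbrev Hat.single (i : Fin (n + 1)) : Hat E := ⟨unitVec i⟩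

/-- The family `(c_{ij})_{(i,j) ∈ I × I}` of objects of `Ĉ`. -/
def cFamily : Mat_ (Hat E) where
  ι := Fin (n + 1) × Fin (n + 1)
  X x := ⟨c x.1 x.2⟩

/-- The algebra `M(R, A, I)`: the direct sum of the spaces of `(c_{i'j'}, c_{ij})`-type matrices,
with the matrix product of composable blocks. The component `f (i, j) (i', j')` of `f` is its
`(c_{i'j'}, c_{ij})`-type part. -/
abbrev MAlg : Type _ := End (cFamily E c)

variable {E c} in
/-- An element of `M(R, A, I)` as a family of morphisms `c_{ij} ⟶ c_{i'j'}`. -/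
def MAlg.toHom (f : MAlg E c) : cFamily E c ⟶ cFamily E c := f

variable {E c} in
/-- The component of type `(c_{i'j'}, c_{ij})` of an element of `M(R, A, I)`, for `x = (i', j')` and
`y = (i, j)`. -/
def MAlg.block (f : MAlg E c) (x y : Fin (n + 1) × Fin (n + 1)) :
    Matrix (Idx (c x.1 x.2)) (Idx (c y.1 y.2)) A :=
  Hat.mat (f.toHom y x)

open Classical in
/-- The element `E_{c_{ij}}` of `M(R, A, I)`. -/
def MAlg.unit (x : Fin (n + 1) × Fin (n + 1)) : MAlg E c :=
  (fun y z => if h : y = x ∧ z = x then eqToHom (by rw [h.1, h.2]) else 0 :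
    Mat_.Hom (cFamily E c) (cFamily E c))

/-- An algebra map `φ : A ⊗ A → M(R, A, I)` with `φ (e_i ⊗ e_j) = E_{c_{ij}}`. -/
structure TensorMap where
  toAlgHom : A ⊗[𝕜] A →ₐ[𝕜] MAlg E c
  map_idem : ∀ i j, toAlgHom (E.e i ⊗ₜ E.e j) = MAlg.unit E c (i, j)

variable {E c}

namespace MAlg

theorem block_mul (f g : MAlg E c) (x z : Fin (n + 1) × Fin (n + 1)) :
    (f * g).block x z = ∑ y, f.block x y * g.block y z := by
  have h : (f * g).toHom z x = ∑ y, g.toHom z y ≫ f.toHom y x := rfl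
  exact (congrArg Hat.mat h).trans (Hat.mat_sum _ _)

theorem block_add (f g : MAlg E c) (x z : Fin (n + 1) × Fin (n + 1)) :
    (f + g).block x z = f.block x z + g.block x z := rfl

theorem unit_self (x : Fin (n + 1) × Fin (n + 1)) : (unit E c x).toHom x x = 𝟙 _ :=
  dif_pos ⟨rfl, rfl⟩

theorem unit_ne (x y z : Fin (n + 1) × Fin (n + 1)) (h : ¬ (y = x ∧ z = x)) :
    (unit E c x).toHom y z = 0 := dif_neg h

theorem block_unit_self (x : Fin (n + 1) × Fin (n + 1)) :
    (unit E c x).block x x = Matrix.diagonal fun p => E.e p.1 := by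
  rw [block, unit_self]
  rfl

theorem block_unit_ne (x y z : Fin (n + 1) × Fin (n + 1)) (h : ¬ (z = x ∧ y = x)) :
    (unit E c x).block y z = 0 := by
  rw [block, unit_ne _ _ _ h]
  rfl

theorem left_block (f : MAlg E c) (x y : Fin (n + 1) × Fin (n + 1)) (p q) :
    E.e p.1 * f.block x y p q = f.block x y p q := Hat.left_mat _ p q

theorem block_right (f : MAlg E c) (x y : Fin (n + 1) × Fin (n + 1)) (p q) :
    f.block x y p q * E.e q.1 = f.block x y p q := Hat.mat_right _ p q

end MAlg

namespace TensorMap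

variable (φ : TensorMap E c)

/-- `φ (x ⊗ y)` is concentrated in the `(c_{i'j'}, c_{ij})` block when `x ∈ e_{i'} A e_i` and
`y ∈ e_{j'} A e_j`. -/
theorem block_eq_zero {x y : A} {i j i' j' : Fin (n + 1)}
    (hx : x * E.e i = x) (hy : y * E.e j = y)
    (w : Fin (n + 1) × Fin (n + 1)) (h : w ≠ (i, j)) :
    (φ.toAlgHom (x ⊗ₜ y)).block (i', j') w = 0 := by
  have h1 : x ⊗ₜ[𝕜] y = x ⊗ₜ y * E.e i ⊗ₜ E.e j := by
    rw [Algebra.TensorProduct.tmul_mul_tmul, hx, hy]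
  rw [h1, map_mul, φ.map_idem, MAlg.block_mul]
  refine Finset.sum_eq_zero fun v _ => ?_
  rw [MAlg.block_unit_ne _ _ _ (fun h' => h h'.1), Matrix.mul_zero]

theorem block_mul_block {x y x' y' : A} {i j : Fin (n + 1)}
    (hx : x * E.e i = x) (hy : y * E.e j = y) (u w : Fin (n + 1) × Fin (n + 1)) :
    (φ.toAlgHom (x ⊗ₜ y)).block u (i, j) * (φ.toAlgHom (x' ⊗ₜ y')).block (i, j) w =
      (φ.toAlgHom ((x * x') ⊗ₜ (y * y'))).block u w := by
  rw [← Algebra.TensorProduct.tmul_mul_tmul, map_mul, MAlg.block_mul]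
  rw [Finset.sum_eq_single (i, j)]
  · intro v _ hv
    rw [φ.block_eq_zero (i' := u.1) (j' := u.2) hx hy v hv, Matrix.zero_mul]
  · simp

/-- The tensor product `X ⊗̂ Y = Π (φ (X ⊗ Y))` of two typed matrices: for rows `p, q` of `X, Y` and
columns `p', q'`, the `(c_{i'j'}, c_{ij})`-type matrix `φ (X p p' ⊗ Y q q')` is inserted at the
position given by concatenation. -/
def tensorHom {m₁ s₁ m₂ s₂ : Hat E} (X : m₁ ⟶ s₁) (Y : m₂ ⟶ s₂) :
    Hat.tensor c m₁ m₂ ⟶ Hat.tensor c s₁ s₂ :=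
  ⟨fun P Q =>
    let x := splitIdx c s₁.mult s₂.mult P
    let y := splitIdx c m₁.mult m₂.mult Q
    (φ.toAlgHom (Hat.mat X x.1.1 y.1.1 ⊗ₜ Hat.mat Y x.1.2 y.1.2)).block
      (x.1.1.1, x.1.2.1) (y.1.1.1, y.1.2.1) x.2 y.2, fun P Q => by
    have h1 := MAlg.left_block (φ.toAlgHom
      (Hat.mat X (splitIdx c s₁.mult s₂.mult P).1.1 (splitIdx c m₁.mult m₂.mult Q).1.1 ⊗ₜ
        Hat.mat Y (splitIdx c s₁.mult s₂.mult P).1.2 (splitIdx c m₁.mult m₂.mult Q).1.2))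
      ((splitIdx c s₁.mult s₂.mult P).1.1.1, (splitIdx c s₁.mult s₂.mult P).1.2.1)
      ((splitIdx c m₁.mult m₂.mult Q).1.1.1, (splitIdx c m₁.mult m₂.mult Q).1.2.1)
      (splitIdx c s₁.mult s₂.mult P).2 (splitIdx c m₁.mult m₂.mult Q).2
    have h2 := MAlg.block_right (φ.toAlgHom
      (Hat.mat X (splitIdx c s₁.mult s₂.mult P).1.1 (splitIdx c m₁.mult m₂.mult Q).1.1 ⊗ₜ
        Hat.mat Y (splitIdx c s₁.mult s₂.mult P).1.2 (splitIdx c m₁.mult m₂.mult Q).1.2))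
      ((splitIdx c s₁.mult s₂.mult P).1.1.1, (splitIdx c s₁.mult s₂.mult P).1.2.1)
      ((splitIdx c m₁.mult m₂.mult Q).1.1.1, (splitIdx c m₁.mult m₂.mult Q).1.2.1)
      (splitIdx c s₁.mult s₂.mult P).2 (splitIdx c m₁.mult m₂.mult Q).2
    exact (congrArg (· * _) h1).trans h2⟩

theorem mat_tensorHom {m₁ s₁ m₂ s₂ : Hat E} (X : m₁ ⟶ s₁) (Y : m₂ ⟶ s₂) (P Q) :
    Hat.mat (φ.tensorHom X Y) P Q =
      (φ.toAlgHom (Hat.mat X (splitIdx c s₁.mult s₂.mult P).1.1 (splitIdx c m₁.mult m₂.mult Q).1.1 ⊗ₜ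
        Hat.mat Y (splitIdx c s₁.mult s₂.mult P).1.2 (splitIdx c m₁.mult m₂.mult Q).1.2)).block
      ((splitIdx c s₁.mult s₂.mult P).1.1.1, (splitIdx c s₁.mult s₂.mult P).1.2.1)
      ((splitIdx c m₁.mult m₂.mult Q).1.1.1, (splitIdx c m₁.mult m₂.mult Q).1.2.1)
      (splitIdx c s₁.mult s₂.mult P).2 (splitIdx c m₁.mult m₂.mult Q).2 := rfl

theorem block_add_left (x x' y : A) (u w) :
    (φ.toAlgHom ((x + x') ⊗ₜ y)).block u w =
      (φ.toAlgHom (x ⊗ₜ y)).block u w + (φ.toAlgHom (x' ⊗ₜ y)).block u w := by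
  rw [TensorProduct.add_tmul, map_add]; rfl

theorem block_add_right (x y y' : A) (u w) :
    (φ.toAlgHom (x ⊗ₜ (y + y'))).block u w =
      (φ.toAlgHom (x ⊗ₜ y)).block u w + (φ.toAlgHom (x ⊗ₜ y')).block u w := by
  rw [TensorProduct.tmul_add, map_add]; rfl

/-- `block` of `φ (x ⊗ y)` as a biadditive map. -/
def blockHom (u w : Fin (n + 1) × Fin (n + 1)) :
    A →+ A →+ Matrix (Idx (c u.1 u.2)) (Idx (c w.1 w.2)) A :=
  AddMonoidHom.mk' (fun x => AddMonoidHom.mk' (fun y => (φ.toAlgHom (x ⊗ₜ y)).block u w)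
    (fun y y' => φ.block_add_right x y y' u w))
    (fun x x' => AddMonoidHom.ext fun y => φ.block_add_left x x' y u w)

theorem tensorHom_add_left {m₁ s₁ m₂ s₂ : Hat E} (X X' : m₁ ⟶ s₁) (Y : m₂ ⟶ s₂) :
    φ.tensorHom (X + X') Y = φ.tensorHom X Y + φ.tensorHom X' Y := by
  apply Hat.hom_ext
  intro P Q
  simp only [mat_tensorHom, Hat.mat_add, Matrix.add_apply, block_add_left]

theorem tensorHom_add_right {m₁ s₁ m₂ s₂ : Hat E} (X : m₁ ⟶ s₁) (Y Y' : m₂ ⟶ s₂) :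
    φ.tensorHom X (Y + Y') = φ.tensorHom X Y + φ.tensorHom X Y' := by
  apply Hat.hom_ext
  intro P Q
  simp only [mat_tensorHom, Hat.mat_add, Matrix.add_apply, block_add_right]

theorem tensorHom_sum_left {ι : Type*} (t : Finset ι) {m₁ s₁ m₂ s₂ : Hat E}
    (X : ι → (m₁ ⟶ s₁)) (Y : m₂ ⟶ s₂) :
    φ.tensorHom (∑ i ∈ t, X i) Y = ∑ i ∈ t, φ.tensorHom (X i) Y :=
  map_sum (AddMonoidHom.mk' (fun X => φ.tensorHom X Y)
    (fun X X' => φ.tensorHom_add_left X X' Y)) X t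

theorem tensorHom_sum_right {ι : Type*} (t : Finset ι) {m₁ s₁ m₂ s₂ : Hat E}
    (X : m₁ ⟶ s₁) (Y : ι → (m₂ ⟶ s₂)) :
    φ.tensorHom X (∑ i ∈ t, Y i) = ∑ i ∈ t, φ.tensorHom X (Y i) :=
  map_sum (AddMonoidHom.mk' (fun Y => φ.tensorHom X Y)
    (fun Y Y' => φ.tensorHom_add_right X Y Y')) Y t

theorem tensorHom_comp {m₁ s₁ t₁ m₂ s₂ t₂ : Hat E} (X : m₁ ⟶ s₁) (X' : s₁ ⟶ t₁)
    (Y : m₂ ⟶ s₂) (Y' : s₂ ⟶ t₂) :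
    φ.tensorHom (X ≫ X') (Y ≫ Y') = φ.tensorHom X Y ≫ φ.tensorHom X' Y' := by
  apply Hat.hom_ext
  intro P Q
  rw [Hat.mat_comp, Matrix.mul_apply, mat_tensorHom]
  simp only [mat_tensorHom, Hat.mat_comp]
  set x := splitIdx c t₁.mult t₂.mult P
  set y := splitIdx c m₁.mult m₂.mult Q
  have h0 := Equiv.sum_comp (splitIdx c s₁.mult s₂.mult)
    (fun w : Σ w : Idx s₁.mult × Idx s₂.mult, Idx (c w.1.1 w.2.1) =>
      (φ.toAlgHom (Hat.mat X' x.1.1 w.1.1 ⊗ₜ Hat.mat Y' x.1.2 w.1.2)).block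
        (x.1.1.1, x.1.2.1) (w.1.1.1, w.1.2.1) x.2 w.2 *
      (φ.toAlgHom (Hat.mat X w.1.1 y.1.1 ⊗ₜ Hat.mat Y w.1.2 y.1.2)).block
        (w.1.1.1, w.1.2.1) (y.1.1.1, y.1.2.1) w.2 y.2)
  have h0' := h0.trans ((Fintype.sum_sigma _).trans (Fintype.sum_prod_type _))
  refine Eq.trans ?_ h0'.symm
  have h1 : ∀ p q, ∑ z : Idx (c p.1 q.1),
      (φ.toAlgHom (Hat.mat X' x.1.1 p ⊗ₜ Hat.mat Y' x.1.2 q)).block (x.1.1.1, x.1.2.1)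
        (p.1, q.1) x.2 z *
      (φ.toAlgHom (Hat.mat X p y.1.1 ⊗ₜ Hat.mat Y q y.1.2)).block (p.1, q.1)
        (y.1.1.1, y.1.2.1) z y.2 =
      (φ.toAlgHom ((Hat.mat X' x.1.1 p * Hat.mat X p y.1.1) ⊗ₜ
        (Hat.mat Y' x.1.2 q * Hat.mat Y q y.1.2))).block (x.1.1.1, x.1.2.1)
        (y.1.1.1, y.1.2.1) x.2 y.2 := by
    intro p q
    rw [← φ.block_mul_block (Hat.mat_right X' x.1.1 p) (Hat.mat_right Y' x.1.2 q)]
    rfl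
  refine Eq.trans ?_ (Finset.sum_congr rfl fun p _ => Finset.sum_congr rfl fun q _ => (h1 p q).symm)
  rw [Matrix.mul_apply, Matrix.mul_apply]
  have h2 : (φ.blockHom (x.1.1.1, x.1.2.1) (y.1.1.1, y.1.2.1)
      (∑ p, Hat.mat X' x.1.1 p * Hat.mat X p y.1.1))
      (∑ q, Hat.mat Y' x.1.2 q * Hat.mat Y q y.1.2) =
      ∑ p, ∑ q, φ.blockHom (x.1.1.1, x.1.2.1) (y.1.1.1, y.1.2.1)
        (Hat.mat X' x.1.1 p * Hat.mat X p y.1.1) (Hat.mat Y' x.1.2 q * Hat.mat Y q y.1.2) := by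
    rw [map_sum (φ.blockHom (x.1.1.1, x.1.2.1) (y.1.1.1, y.1.2.1)), AddMonoidHom.finsetSum_apply]
    exact Finset.sum_congr rfl fun p _ => map_sum _ _ _
  refine (congrFun (congrFun h2 x.2) y.2).trans ?_
  simp only [Matrix.sum_apply]
  rfl

theorem tensorHom_id (m s : Hat E) :
    φ.tensorHom (𝟙 m) (𝟙 s) = 𝟙 (Hat.tensor c m s) := by
  apply Hat.hom_ext
  intro P Q
  rw [mat_tensorHom, Hat.mat_id, Hat.mat_id, Hat.mat_id]
  by_cases h : P = Q
  · subst h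
    simp only [Matrix.diagonal_apply_eq, φ.map_idem, MAlg.block_unit_self]
    rfl
  · rw [Matrix.diagonal_apply_ne _ h]
    have key : ∀ x y : (Σ w : Idx m.mult × Idx s.mult, Idx (c w.1.1 w.2.1)), x ≠ y →
        (φ.toAlgHom (Matrix.diagonal (fun p : Idx m.mult => E.e p.1) x.1.1 y.1.1 ⊗ₜ
          Matrix.diagonal (fun p : Idx s.mult => E.e p.1) x.1.2 y.1.2)).block
          (x.1.1.1, x.1.2.1) (y.1.1.1, y.1.2.1) x.2 y.2 = 0 := by
      rintro ⟨⟨p, q⟩, t⟩ ⟨⟨p', q'⟩, t'⟩ h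
      by_cases hp : p = p'
      · by_cases hq : q = q'
        · subst hp hq
          have ht : t ≠ t' := fun h' => h (by rw [h'])
          simp only [Matrix.diagonal_apply_eq, φ.map_idem]
          have h2 := congrFun (congrFun
            (MAlg.block_unit_self (E := E) (c := c) (p.1, q.1)) t) t'
          exact h2.trans (Matrix.diagonal_apply_ne (fun p => E.e p.1) ht)
        · simp only [Matrix.diagonal_apply_ne (fun p : Idx s.mult => E.e p.1) hq,
            TensorProduct.tmul_zero, map_zero]
          rfl
      · simp only [Matrix.diagonal_apply_ne (fun p : Idx m.mult => E.e p.1) hp,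
          TensorProduct.zero_tmul, map_zero]
        rfl
    exact key _ _ fun h' => h ((splitIdx c m.mult s.mult).injective h')

end TensorMap

end Tensor

/-! ### Decompositions into finite direct sums -/

section SumDec

variable {D : Type*} [Category D] [Preadditive D] {W : Type} [Fintype W]

/-- A presentation of `P` as the direct sum of the finite family `U`: inclusions, projections. -/
structure SumDec (P : D) (U : W → D) where
  inc : ∀ w, U w ⟶ P
  prj : ∀ w, P ⟶ U w
  inc_prj : ∀ w, inc w ≫ prj w = 𝟙 (U w)
  inc_prj_ne : ∀ w w', w ≠ w' → inc w ≫ prj w' = 0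
  total : ∑ w, prj w ≫ inc w = 𝟙 P

variable {P Q : D} {U U' : W → D}

theorem SumDec.map_aux (d : SumDec P U) (d' : SumDec Q U') (g : ∀ w, U w ≅ U' w) :
    (∑ w, d.prj w ≫ (g w).hom ≫ d'.inc w) ≫ (∑ w, d'.prj w ≫ (g w).inv ≫ d.inc w) = 𝟙 P := by
  rw [← d.total, Preadditive.sum_comp]
  refine Finset.sum_congr rfl fun w _ => ?_
  rw [Preadditive.comp_sum, Finset.sum_eq_single w]
  · simp only [Category.assoc]
    rw [← Category.assoc (d'.inc w), d'.inc_prj, Category.id_comp, Iso.hom_inv_id_assoc]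
  · intro w' _ h
    simp only [Category.assoc]
    rw [← Category.assoc (d'.inc w), d'.inc_prj_ne w w' (Ne.symm h)]
    simp
  · simp

/-- The direct sum of a family of isomorphisms. -/
def SumDec.mapIso (d : SumDec P U) (d' : SumDec Q U') (g : ∀ w, U w ≅ U' w) : P ≅ Q where
  hom := ∑ w, d.prj w ≫ (g w).hom ≫ d'.inc w
  inv := ∑ w, d'.prj w ≫ (g w).inv ≫ d.inc w
  hom_inv_id := SumDec.map_aux d d' g
  inv_hom_id := SumDec.map_aux d' d fun w => (g w).symm

/-- Change of the index set of a direct sum. -/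
def SumDec.reindex {W' : Type} [Fintype W'] (d : SumDec P U) (e : W' ≃ W) :
    SumDec P (fun w => U (e w)) where
  inc w := d.inc (e w)
  prj w := d.prj (e w)
  inc_prj w := d.inc_prj (e w)
  inc_prj_ne _ _ h := d.inc_prj_ne _ _ (e.injective.ne h)
  total := (Equiv.sum_comp e fun w => d.prj w ≫ d.inc w).trans d.total

end SumDec

/-! ### The tensor product, unit and associativity constraint of `Ĉ` -/

section Reconstruct

variable {𝕜 A : Type*} [Field 𝕜] [Ring A] [Algebra 𝕜 A] {n : ℕ} {E : IdemFamily 𝕜 A n}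

theorem unitVec_idx {i : Fin (n + 1)} (w : Idx (unitVec i)) : w = ⟨i, ⟨0, by simp⟩⟩ := by
  obtain ⟨j, k⟩ := w
  have h : j = i := by
    by_contra h
    have := k.2
    simp [h] at this
  subst h
  have hk := k.2
  simp only [Pi.single_eq_same] at hk
  refine Sigma.ext rfl (heq_of_eq (Fin.ext ?_))
  simpa using hk

/-- The insertion `X_p`: the column with the idempotent `e_i` at position `p` (in block `i`). -/
def Hat.ins (m : Hat E) (p : Idx m.mult) : Hat.single E p.1 ⟶ m :=
  ⟨fun p' _ => if p' = p then E.e p.1 else 0, fun p' w => by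
    have hw : w.1 = p.1 := congrArg Sigma.fst (unitVec_idx w)
    rw [hw]
    by_cases h : p' = p
    · subst h; simp [E.e_mul_e]
    · simp [h]⟩

/-- The projection `Y_p`: the row with the idempotent `e_i` at position `p` (in block `i`). -/
def Hat.prj (m : Hat E) (p : Idx m.mult) : m ⟶ Hat.single E p.1 :=
  ⟨fun _ p' => if p' = p then E.e p.1 else 0, fun w p' => by
    have hw : w.1 = p.1 := congrArg Sigma.fst (unitVec_idx w)
    rw [hw]
    by_cases h : p' = p
    · subst h; simp [E.e_mul_e]
    · simp [h]⟩

theorem Hat.mat_ins (m : Hat E) (p p' : Idx m.mult) (w : Idx (unitVec p.1)) :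
    Hat.mat (Hat.ins m p) p' w = if p' = p then E.e p.1 else 0 := rfl

theorem Hat.mat_prj (m : Hat E) (p p' : Idx m.mult) (w : Idx (unitVec p.1)) :
    Hat.mat (Hat.prj m p) w p' = if p' = p then E.e p.1 else 0 := rfl

theorem sum_unitVec {M : Type*} [AddCommMonoid M] (i : Fin (n + 1)) (f : Idx (unitVec i) → M) :
    ∑ w, f w = f ⟨i, ⟨0, by simp⟩⟩ := by
  refine Finset.sum_eq_single _ (fun w _ h => absurd (unitVec_idx w) h) (by simp)

/-- Every `m` is the direct sum of the `e_i`, with multiplicities `m_i`. -/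
def Hat.dec (m : Hat E) : SumDec m (fun p : Idx m.mult => Hat.single E p.1) where
  inc p := Hat.ins m p
  prj p := Hat.prj m p
  inc_prj p := by
    apply Hat.hom_ext
    intro w w'
    rw [unitVec_idx w, unitVec_idx w', Hat.mat_comp, Matrix.mul_apply, Hat.mat_id]
    simp [Hat.mat_ins, Hat.mat_prj, E.e_mul_e]
  inc_prj_ne p q h := by
    apply Hat.hom_ext
    intro w w'
    rw [Hat.mat_comp, Matrix.mul_apply]
    simp only [Hat.mat_ins, Hat.mat_prj]
    simp
    exact fun h' => absurd h' h
  total := by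
    apply Hat.hom_ext
    intro p q
    rw [Hat.mat_sum, Matrix.sum_apply, Hat.mat_id]
    have h (r : Idx m.mult) : Hat.mat (Hat.prj m r ≫ Hat.ins m r) p q =
        if r = p then (if p = q then E.e p.1 else 0) else 0 := by
      rw [Hat.mat_comp, Matrix.mul_apply, sum_unitVec]
      rw [Hat.mat_ins, Hat.mat_prj]
      by_cases hp : p = r
      · subst hp
        by_cases hq : q = p
        · subst hq; simp [E.e_mul_e]
        · simp [hq, Ne.symm hq]
      · simp [hp, Ne.symm hp]
    simp only [h, Finset.sum_ite_eq', Finset.mem_univ, if_true]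
    rfl

variable {c : Fin (n + 1) → Fin (n + 1) → Fin (n + 1) → ℕ}

theorem TensorMap.tensorHom_zero_left (φ : TensorMap E c) {m₁ s₁ m₂ s₂ : Hat E} (Y : m₂ ⟶ s₂) :
    φ.tensorHom (0 : m₁ ⟶ s₁) Y = 0 := by
  have h := φ.tensorHom_sum_left (∅ : Finset ℕ) (fun _ => (0 : m₁ ⟶ s₁)) Y
  rwa [Finset.sum_empty, Finset.sum_empty] at h

theorem TensorMap.tensorHom_zero_right (φ : TensorMap E c) {m₁ s₁ m₂ s₂ : Hat E} (X : m₁ ⟶ s₁) :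
    φ.tensorHom X (0 : m₂ ⟶ s₂) = 0 := by
  have h := φ.tensorHom_sum_right (∅ : Finset ℕ) X (fun _ => (0 : m₂ ⟶ s₂))
  rwa [Finset.sum_empty, Finset.sum_empty] at h

/-- The tensor product `⊗̂` of two direct sums. -/
def TensorMap.sumDec (φ : TensorMap E c) {W W' : Type} [Fintype W] [Fintype W'] {P P' : Hat E}
    {U : W → Hat E} {U' : W' → Hat E} (d : SumDec P U) (d' : SumDec P' U') :
    SumDec (Hat.tensor c P P')
      (fun w : W × W' => Hat.tensor c (U w.1) (U' w.2)) where
  inc w := φ.tensorHom (d.inc w.1) (d'.inc w.2)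
  prj w := φ.tensorHom (d.prj w.1) (d'.prj w.2)
  inc_prj w := by rw [← φ.tensorHom_comp, d.inc_prj, d'.inc_prj, φ.tensorHom_id]
  inc_prj_ne w w' h := by
    rw [← φ.tensorHom_comp]
    by_cases h1 : w.1 = w'.1
    · have h2 : w.2 ≠ w'.2 := fun h2 => h (Prod.ext h1 h2)
      rw [d'.inc_prj_ne _ _ h2, φ.tensorHom_zero_right]
    · rw [d.inc_prj_ne _ _ h1, φ.tensorHom_zero_left]
  total := by
    rw [← φ.tensorHom_id, ← d.total, ← d'.total, φ.tensorHom_sum_left, Fintype.sum_prod_type]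
    refine Finset.sum_congr rfl fun p _ => ?_
    rw [φ.tensorHom_sum_right]
    exact Finset.sum_congr rfl fun q _ => (φ.tensorHom_comp _ _ _ _).symm

end Reconstruct

/-- A quadruple `(R, A, φ, a)`: a ring `R` with a unital `ℤ₊`-basis, an algebra `A` with a complete
family of orthogonal idempotents, an algebra map `φ : A ⊗ A → M(R, A, I)` and a family of invertible
matrices `a_{ijl}` of type `(e_i ⊗̂ (e_j ⊗̂ e_l), (e_i ⊗̂ e_j) ⊗̂ e_l)`. -/
structure Quadruple (𝕜 R A : Type*) [Field 𝕜] [Ring R] [Ring A] [Algebra 𝕜 A] (n : ℕ) where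
  basis : ZPlusBasis R n
  idem : IdemFamily 𝕜 A n
  φ : TensorMap idem basis.c
  a : ∀ i j l : Fin (n + 1),
    Hat.tensor basis.c (Hat.tensor basis.c (Hat.single idem i) (Hat.single idem j))
      (Hat.single idem l) ≅
    Hat.tensor basis.c (Hat.single idem i)
      (Hat.tensor basis.c (Hat.single idem j) (Hat.single idem l))

namespace Quadruple

variable {𝕜 R A : Type*} [Field 𝕜] [Ring R] [Ring A] [Algebra 𝕜 A] {n : ℕ}

/-- The associativity constraint, with the sum over triples of rows. -/
def assocAux (Q : Quadruple 𝕜 R A n) (m s t : Hat Q.idem) :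
    Hat.tensor Q.basis.c (Hat.tensor Q.basis.c m s) t ≅
      Hat.tensor Q.basis.c m (Hat.tensor Q.basis.c s t) :=
  SumDec.mapIso (Q.φ.sumDec (Q.φ.sumDec m.dec s.dec) t.dec)
    ((Q.φ.sumDec m.dec (Q.φ.sumDec s.dec t.dec)).reindex (Equiv.prodAssoc _ _ _))
    fun w => Q.a w.1.1.1 w.1.2.1 w.2.1

theorem assocAux_hom (Q : Quadruple 𝕜 R A n) (m s t : Hat Q.idem) :
    (Q.assocAux m s t).hom = ∑ p : Idx m.mult, ∑ q : Idx s.mult, ∑ r : Idx t.mult,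
      Q.φ.tensorHom (Q.φ.tensorHom (Hat.prj m p) (Hat.prj s q)) (Hat.prj t r) ≫
        (Q.a p.1 q.1 r.1).hom ≫
          Q.φ.tensorHom (Hat.ins m p) (Q.φ.tensorHom (Hat.ins s q) (Hat.ins t r)) :=
  (Fintype.sum_prod_type _).trans (Fintype.sum_prod_type _)

theorem assocAux_inv (Q : Quadruple 𝕜 R A n) (m s t : Hat Q.idem) :
    (Q.assocAux m s t).inv = ∑ p : Idx m.mult, ∑ q : Idx s.mult, ∑ r : Idx t.mult,
      Q.φ.tensorHom (Hat.prj m p) (Q.φ.tensorHom (Hat.prj s q) (Hat.prj t r)) ≫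
        (Q.a p.1 q.1 r.1).inv ≫
          Q.φ.tensorHom (Q.φ.tensorHom (Hat.ins m p) (Hat.ins s q)) (Hat.ins t r) :=
  (Fintype.sum_prod_type _).trans (Fintype.sum_prod_type _)

/-- The associativity constraint `a_{m,s,t} = ∑ (X_p ⊗̂ (X_q ⊗̂ X_r)) a_{ijl} ((Y_p ⊗̂ Y_q) ⊗̂ Y_r)`,
where `p, q, r` run over the rows of type `m, s, t` and `i, j, l` are their blocks. -/
def assoc (Q : Quadruple 𝕜 R A n) (m s t : Hat Q.idem) :
    Hat.tensor Q.basis.c (Hat.tensor Q.basis.c m s) t ≅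
      Hat.tensor Q.basis.c m (Hat.tensor Q.basis.c s t) where
  hom := ∑ p : Idx m.mult, ∑ q : Idx s.mult, ∑ r : Idx t.mult,
    Q.φ.tensorHom (Q.φ.tensorHom (Hat.prj m p) (Hat.prj s q)) (Hat.prj t r) ≫
      (Q.a p.1 q.1 r.1).hom ≫
        Q.φ.tensorHom (Hat.ins m p) (Q.φ.tensorHom (Hat.ins s q) (Hat.ins t r))
  inv := ∑ p : Idx m.mult, ∑ q : Idx s.mult, ∑ r : Idx t.mult,
    Q.φ.tensorHom (Hat.prj m p) (Q.φ.tensorHom (Hat.prj s q) (Hat.prj t r)) ≫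
      (Q.a p.1 q.1 r.1).inv ≫
        Q.φ.tensorHom (Q.φ.tensorHom (Hat.ins m p) (Hat.ins s q)) (Hat.ins t r)
  hom_inv_id := by
    rw [← Q.assocAux_hom, ← Q.assocAux_inv, Iso.hom_inv_id]
  inv_hom_id := by
    rw [← Q.assocAux_hom, ← Q.assocAux_inv, Iso.inv_hom_id]

end Quadruple

namespace Quadruple

variable {𝕜 R A : Type*} [Field 𝕜] [Ring R] [Ring A] [Algebra 𝕜 A] {n : ℕ}

/-- The category `Ĉ` constructed from the quadruple `(R, A, φ, a)`. -/
def Recon (Q : Quadruple 𝕜 R A n) : Type := Hat Q.idem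

variable (Q : Quadruple 𝕜 R A n)

instance : Category Q.Recon := inferInstanceAs (Category (Hat Q.idem))

instance : Preadditive Q.Recon := inferInstanceAs (Preadditive (Hat Q.idem))

instance : Linear 𝕜 Q.Recon := inferInstanceAs (Linear 𝕜 (Hat Q.idem))

/-- The tensor product `⊗̂` of `Ĉ` on objects and morphisms, the unit object `e_0`, the associativity
constraint `a_{m,s,t}`, and the identities as unit constraints. -/
abbrev tensorStruct : MonoidalCategoryStruct Q.Recon where
  tensorObj m s := Hat.tensor Q.basis.c m s
  tensorHom f g := Q.φ.tensorHom f g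
  whiskerLeft m _ _ f := Q.φ.tensorHom (𝟙 (m : Hat Q.idem)) f
  whiskerRight f m := Q.φ.tensorHom f (𝟙 (m : Hat Q.idem))
  tensorUnit := Hat.single Q.idem 0
  associator m s t := Q.assoc m s t
  leftUnitor m := eqToIso (C := Hat Q.idem) (Hat.ext (Q.basis.tens_zero_left m.mult))
  rightUnitor m := eqToIso (C := Hat Q.idem) (Hat.ext (Q.basis.tens_zero_right m.mult))

end Quadruple

/-- Two matrices, over `A` and over `A'`, have the same shape and `δ : A → A'` maps the entries of the
first one to those of the second one. -/
def Matches {A A' : Type*} {n : ℕ} (δ : A → A') {s m s' m' : Fin (n + 1) → ℕ}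
    (X : Matrix (Idx s) (Idx m) A) (Y : Matrix (Idx s') (Idx m') A') : Prop :=
  s = s' ∧ m = m' ∧ ∀ (i j : Fin (n + 1)) (k l : ℕ) (hk : k < s i) (hk' : k < s' i)
    (hl : l < m j) (hl' : l < m' j), δ (X ⟨i, k, hk⟩ ⟨j, l, hl⟩) = Y ⟨i, k, hk'⟩ ⟨j, l, hl'⟩

/-- An isomorphism of quadruples `(R, A, φ, a) ≅ (R', A', φ', a')`: a ring isomorphism `R ≅ R'`
respecting the bases and an algebra isomorphism `A ≅ A'` respecting the idempotents, under which `φ`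
corresponds to `φ'` and `a_{ijl}` to `a'_{ijl}`. -/
structure QuadrupleIso {𝕜 R A R' A' : Type*} [Field 𝕜] [Ring R] [Ring A] [Algebra 𝕜 A] [Ring R']
    [Ring A'] [Algebra 𝕜 A'] {n : ℕ} (Q : Quadruple 𝕜 R A n) (Q' : Quadruple 𝕜 R' A' n) where
  ringEquiv : R ≃+* R'
  map_basis : ∀ i, ringEquiv (Q.basis.basis i) = Q'.basis.basis i
  algEquiv : A ≃ₐ[𝕜] A'
  map_idem : ∀ i, algEquiv (Q.idem.e i) = Q'.idem.e i
  map_φ : ∀ (x : A ⊗[𝕜] A) (u w : Fin (n + 1) × Fin (n + 1)),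
    Matches algEquiv ((Q.φ.toAlgHom x).block u w)
      ((Q'.φ.toAlgHom (Algebra.TensorProduct.congr algEquiv algEquiv x)).block u w)
  map_a : ∀ i j l, Matches algEquiv (Hat.mat (Q.a i j l).hom) (Hat.mat (Q'.a i j l).hom)

/-! ### Krull–Schmidt categories and the Green ring -/

/-- A Krull–Schmidt category: every object is a finite direct sum of indecomposable objects, in an
essentially unique way. -/
class IsKrullSchmidt (C : Type u) [Category.{v} C] [Preadditive C] [HasFiniteBiproducts C]
    [HasBinaryBiproducts C] : Prop where
  exists_decomp : ∀ X : C, ∃ (r : ℕ) (f : Fin r → C), (∀ i, Indecomposable (f i)) ∧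
    Nonempty (X ≅ ⨁ f)
  unique_decomp : ∀ {J K : Type} [Finite J] [Finite K] (f : J → C) (g : K → C),
    (∀ j, Indecomposable (f j)) → (∀ k, Indecomposable (g k)) → Nonempty ((⨁ f) ≅ ⨁ g) →
      ∃ σ : J ≃ K, ∀ j, Nonempty (f j ≅ g (σ j))

section Biproducts

variable {C : Type u} [Category.{v} C] [Preadditive C] [HasFiniteBiproducts C]
  [HasBinaryBiproducts C]

/-- The biproduct of a finite family, with its inclusions and projections. -/
def biproductDec {W : Type} [Fintype W] (f : W → C) : SumDec (⨁ f) f where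
  inc := biproduct.ι f
  prj := biproduct.π f
  inc_prj := biproduct.ι_π_self f
  inc_prj_ne _ _ h := biproduct.ι_π_ne f h
  total := biproduct.total

/-- The decomposition of `P ⊞ Q` obtained from decompositions of `P` and `Q`. -/
def SumDec.sum {W W' : Type} [Fintype W] [Fintype W'] {P Q : C} {f : W → C} {g : W' → C}
    (d : SumDec P f) (d' : SumDec Q g) : SumDec (P ⊞ Q) (Sum.elim f g) where
  inc w := match w with
    | Sum.inl w => d.inc w ≫ biprod.inl
    | Sum.inr w => d'.inc w ≫ biprod.inr
  prj w := match w with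
    | Sum.inl w => biprod.fst ≫ d.prj w
    | Sum.inr w => biprod.snd ≫ d'.prj w
  inc_prj w := by
    rcases w with w | w
    · simp [d.inc_prj]
    · simp [d'.inc_prj]
  inc_prj_ne w w' h := by
    rcases w with w | w <;> rcases w' with w' | w'
    · have h1 := d.inc_prj_ne w w' (fun h' => h (by rw [h']))
      change (d.inc w ≫ biprod.inl) ≫ biprod.fst ≫ d.prj w' = (0 : f w ⟶ f w')
      simpa using h1
    · change (d.inc w ≫ biprod.inl) ≫ biprod.snd ≫ d'.prj w' = (0 : f w ⟶ g w')
      simp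
    · change (d'.inc w ≫ biprod.inr) ≫ biprod.fst ≫ d.prj w' = (0 : g w ⟶ f w')
      simp
    · have h1 := d'.inc_prj_ne w w' (fun h' => h (by rw [h']))
      change (d'.inc w ≫ biprod.inr) ≫ biprod.snd ≫ d'.prj w' = (0 : g w ⟶ g w')
      simpa using h1
  total := by
    have h1 : ∑ w, (biprod.fst ≫ d.prj w) ≫ (d.inc w ≫ biprod.inl) =
        (biprod.fst ≫ biprod.inl : P ⊞ Q ⟶ P ⊞ Q) := by
      have h : (biprod.fst ≫ (∑ w, d.prj w ≫ d.inc w) ≫ biprod.inl : P ⊞ Q ⟶ P ⊞ Q) =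
          biprod.fst ≫ biprod.inl := by rw [d.total, Category.id_comp]
      rw [← h]
      simp [Preadditive.comp_sum, Preadditive.sum_comp]
    have h2 : ∑ w, (biprod.snd ≫ d'.prj w) ≫ (d'.inc w ≫ biprod.inr) =
        (biprod.snd ≫ biprod.inr : P ⊞ Q ⟶ P ⊞ Q) := by
      have h : (biprod.snd ≫ (∑ w, d'.prj w ≫ d'.inc w) ≫ biprod.inr : P ⊞ Q ⟶ P ⊞ Q) =
          biprod.snd ≫ biprod.inr := by rw [d'.total, Category.id_comp]
      rw [← h]
      simp [Preadditive.comp_sum, Preadditive.sum_comp]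
    rw [Fintype.sum_sum_type]
    exact (congrArg₂ (· + ·) h1 h2).trans biprod.total

/-- Transport of a decomposition along an isomorphism. -/
def SumDec.ofIso {W : Type} [Fintype W] {P Q : C} {f : W → C} (e : P ≅ Q) (d : SumDec P f) :
    SumDec Q f where
  inc w := d.inc w ≫ e.hom
  prj w := e.inv ≫ d.prj w
  inc_prj w := by simp [d.inc_prj]
  inc_prj_ne w w' h := by simp [d.inc_prj_ne w w' h]
  total := by
    have h : ∑ w, (e.inv ≫ d.prj w) ≫ d.inc w ≫ e.hom = e.inv ≫ (∑ w, d.prj w ≫ d.inc w) ≫ e.hom := by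
      simp [Preadditive.comp_sum, Preadditive.sum_comp]
    rw [h, d.total]; simp

/-- Two objects with the same decomposition are isomorphic. -/
def SumDec.iso {W : Type} [Fintype W] {P Q : C} {f : W → C} (d : SumDec P f) (d' : SumDec Q f) :
    P ≅ Q := d.mapIso d' fun _ => Iso.refl _

theorem SumDec.unique [IsKrullSchmidt C] {J K : Type} [Fintype J] [Fintype K] {X : C} {f : J → C}
    {g : K → C} (d : SumDec X f) (d' : SumDec X g) (hf : ∀ j, Indecomposable (f j))
    (hg : ∀ k, Indecomposable (g k)) : ∃ σ : J ≃ K, ∀ j, Nonempty (f j ≅ g (σ j)) :=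
  IsKrullSchmidt.unique_decomp f g hf hg ⟨((biproductDec f).iso d).trans (d'.iso (biproductDec g))⟩

/-- Representatives `V₀ = 𝟙, V₁, …, Vₙ` of the isomorphism classes of indecomposable objects. -/
structure IndecReps (C : Type u) [Category.{v} C] [Preadditive C] [HasBinaryBiproducts C]
    [MonoidalCategoryStruct C] (n : ℕ) where
  V : Fin (n + 1) → C
  indecomposable : ∀ i, Indecomposable (V i)
  eq_of_iso : ∀ i j, Nonempty (V i ≅ V j) → i = j
  exists_iso : ∀ X : C, Indecomposable X → ∃ i, Nonempty (X ≅ V i)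
  V_zero : V 0 = 𝟙_ C

end Biproducts

section Green

theorem toSkeleton_eq_of_iso {C : Type u} [Category.{v} C] {X Y : C} (e : X ≅ Y) :
    toSkeleton X = toSkeleton Y := Quotient.sound ⟨e⟩

variable (C : Type u) [Category.{v} C] [Preadditive C] [HasBinaryBiproducts C]
  [MonoidalCategory C]

/-- The relations `[M ⊕ N] = [M] + [N]` between isomorphism classes of objects. -/
def greenRel : Set (FreeAbelianGroup (Skeleton C)) :=
  {z | ∃ M N : C, z = FreeAbelianGroup.of (toSkeleton (M ⊞ N)) -
    FreeAbelianGroup.of (toSkeleton M) - FreeAbelianGroup.of (toSkeleton N)}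

variable {C}

variable [MonoidalPreadditive C]

theorem of_mul_greenRel (x : Skeleton C) {z : FreeAbelianGroup (Skeleton C)} (hz : z ∈ greenRel C) :
    FreeAbelianGroup.of x * z ∈ greenRel C := by
  obtain ⟨M, N, rfl⟩ := hz
  obtain ⟨X, rfl⟩ := Quotient.exists_rep x
  change FreeAbelianGroup.of (toSkeleton X) * _ ∈ _
  refine ⟨X ⊗ M, X ⊗ N, ?_⟩
  have h : toSkeleton ((X ⊗ M) ⊞ (X ⊗ N)) = toSkeleton (X ⊗ (M ⊞ N)) :=
    
    haveI : PreservesBinaryBiproducts (tensorLeft X) := preservesBinaryBiproducts_of_preservesBiproducts _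
    toSkeleton_eq_of_iso ((tensorLeft X).mapBiprod M N).symm
  rw [h]
  simp only [Skeleton.toSkeleton_tensorObj, mul_sub, FreeAbelianGroup.of_mul_of]

theorem greenRel_mul_of (x : Skeleton C) {z : FreeAbelianGroup (Skeleton C)} (hz : z ∈ greenRel C) :
    z * FreeAbelianGroup.of x ∈ greenRel C := by
  obtain ⟨M, N, rfl⟩ := hz
  obtain ⟨X, rfl⟩ := Quotient.exists_rep x
  change _ * FreeAbelianGroup.of (toSkeleton X) ∈ _
  refine ⟨M ⊗ X, N ⊗ X, ?_⟩
  have h : toSkeleton ((M ⊗ X) ⊞ (N ⊗ X)) = toSkeleton ((M ⊞ N) ⊗ X) :=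
    
    haveI : PreservesBinaryBiproducts (tensorRight X) := preservesBinaryBiproducts_of_preservesBiproducts _
    toSkeleton_eq_of_iso ((tensorRight X).mapBiprod M N).symm
  rw [h]
  simp only [Skeleton.toSkeleton_tensorObj, sub_mul, FreeAbelianGroup.of_mul_of]

theorem mul_mem_green (r : FreeAbelianGroup (Skeleton C)) {z : FreeAbelianGroup (Skeleton C)}
    (hz : z ∈ AddSubgroup.closure (greenRel C)) : r * z ∈ AddSubgroup.closure (greenRel C) := by
  induction r using FreeAbelianGroup.induction_on with
  | zero => simp
  | of x =>
    induction hz using AddSubgroup.closure_induction with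
    | mem z hz => exact AddSubgroup.subset_closure (of_mul_greenRel x hz)
    | zero => simp
    | add a b _ _ ha hb => rw [mul_add]; exact add_mem ha hb
    | neg a _ ha => rw [mul_neg]; exact neg_mem ha
  | neg x hx => rw [neg_mul]; exact neg_mem hx
  | add a b ha hb => rw [add_mul]; exact add_mem ha hb

theorem green_mul_mem (r : FreeAbelianGroup (Skeleton C)) {z : FreeAbelianGroup (Skeleton C)}
    (hz : z ∈ AddSubgroup.closure (greenRel C)) : z * r ∈ AddSubgroup.closure (greenRel C) := by
  induction r using FreeAbelianGroup.induction_on with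
  | zero => simp
  | of x =>
    induction hz using AddSubgroup.closure_induction with
    | mem z hz => exact AddSubgroup.subset_closure (greenRel_mul_of x hz)
    | zero => simp
    | add a b _ _ ha hb => rw [add_mul]; exact add_mem ha hb
    | neg a _ ha => rw [neg_mul]; exact neg_mem ha
  | neg x hx => rw [mul_neg]; exact neg_mem hx
  | add a b ha hb => rw [mul_add]; exact add_mem ha hb

variable (C)

/-- The subgroup generated by the relations, which is a two-sided ideal. -/
def greenIdeal : Ideal (FreeAbelianGroup (Skeleton C)) where
  carrier := AddSubgroup.closure (greenRel C)
  add_mem' := add_mem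
  zero_mem' := zero_mem _
  smul_mem' r _ hz := mul_mem_green r hz

instance : (greenIdeal C).IsTwoSided := ⟨fun r hz => green_mul_mem r hz⟩

/-- The Green ring `r(C)`: the abelian group generated by the isomorphism classes `[M]` of objects,
modulo the relations `[M ⊕ N] = [M] + [N]`, with the product `[M] [N] = [M ⊗ N]`. -/
abbrev GreenRing : Type u := FreeAbelianGroup (Skeleton C) ⧸ greenIdeal C

variable {C}

/-- The class `[X]` in the Green ring. -/
def cls (X : C) : GreenRing C :=
  Ideal.Quotient.mk (greenIdeal C) (FreeAbelianGroup.of (toSkeleton X))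

theorem cls_iso {X Y : C} (e : X ≅ Y) : cls X = cls Y := by
  rw [cls, cls, toSkeleton_eq_of_iso e]

theorem cls_unit : cls (𝟙_ C) = 1 := by
  rw [cls, ← Skeleton.one_eq, ← FreeAbelianGroup.one_def, map_one]

theorem cls_mul (X Y : C) : cls X * cls Y = cls (X ⊗ Y) := by
  rw [cls, cls, cls, Skeleton.toSkeleton_tensorObj, ← map_mul, FreeAbelianGroup.of_mul_of]

theorem cls_biprod (X Y : C) : cls (X ⊞ Y) = cls X + cls Y := by
  rw [cls, cls, cls, ← map_add, Ideal.Quotient.mk_eq_mk_iff_sub_mem, ← sub_sub]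
  exact AddSubgroup.subset_closure ⟨X, Y, rfl⟩

variable [HasFiniteBiproducts C]

theorem cls_sumDec_fin {r : ℕ} : ∀ {X : C} {f : Fin r → C} (_ : SumDec X f),
    cls X = ∑ i, cls (f i) := by
  induction r with
  | zero =>
    intro X f d
    have e : X ⊞ X ≅ X := ((d.sum d).reindex (Equiv.equivOfIsEmpty (Fin 0) (Fin 0 ⊕ Fin 0))).mapIso d
      (fun i => i.elim0)
    have h := cls_biprod X X
    rw [cls_iso e] at h
    simpa using h
  | succ r ih =>
    intro X f d
    have d' : SumDec (f 0 ⊞ ⨁ fun i : Fin r => f i.succ)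
        (Sum.elim (fun _ : Unit => f 0) fun i : Fin r => f i.succ) :=
      SumDec.sum ⟨fun _ => 𝟙 _, fun _ => 𝟙 _, by simp, fun _ _ h => absurd rfl h, by simp⟩
        (biproductDec _)
    let e : Unit ⊕ Fin r ≃ Fin (r + 1) :=
      (Equiv.sumComm _ _).trans ((Equiv.optionEquivSumPUnit _).symm.trans (finSuccEquiv r).symm)
    have e' : X ≅ f 0 ⊞ ⨁ fun i : Fin r => f i.succ := (d.reindex e).mapIso d' fun w => by
      rcases w with w | w
      · exact eqToIso (by simp [e])
      · exact eqToIso (by simp [e])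
    rw [cls_iso e', cls_biprod, ih (biproductDec _), Fin.sum_univ_succ]

theorem cls_sumDec {W : Type} [Fintype W] {X : C} {f : W → C} (d : SumDec X f) :
    cls X = ∑ w, cls (f w) := by
  rw [cls_sumDec_fin (d.reindex (Fintype.equivFin W).symm)]
  exact Equiv.sum_comp (Fintype.equivFin W).symm fun w => cls (f w)

end Green

section GreenBasis

variable {C : Type u} [Category.{v} C] [Preadditive C] [HasFiniteBiproducts C]
  [HasBinaryBiproducts C] [MonoidalCategory C] [IsKrullSchmidt C] {n : ℕ}

theorem exists_sumDec (X : C) : ∃ (r : ℕ) (f : Fin r → C), (∀ i, Indecomposable (f i)) ∧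
    Nonempty (SumDec X f) := by
  obtain ⟨r, f, hf, ⟨e⟩⟩ := IsKrullSchmidt.exists_decomp X
  exact ⟨r, f, hf, ⟨SumDec.ofIso e.symm (biproductDec f)⟩⟩

/-- The multiplicity of `V i` in a decomposition of `X` into indecomposable objects. -/
def mult (S : IndecReps C n) (X : C) (i : Fin (n + 1)) : ℕ :=
  Nat.card {k : Fin (exists_sumDec X).choose //
    Nonempty ((exists_sumDec X).choose_spec.choose k ≅ S.V i)}

theorem mult_eq (S : IndecReps C n) {X : C} {W : Type} [Fintype W] {f : W → C} (d : SumDec X f)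
    (hf : ∀ w, Indecomposable (f w)) (i : Fin (n + 1)) :
    mult S X i = Nat.card {w : W // Nonempty (f w ≅ S.V i)} := by
  obtain ⟨hg, ⟨d'⟩⟩ := (exists_sumDec X).choose_spec.choose_spec
  obtain ⟨σ, hσ⟩ := d'.unique d hg hf
  refine Nat.card_congr (σ.subtypeEquiv fun k => ?_)
  obtain ⟨e⟩ := hσ k
  exact ⟨fun ⟨e'⟩ => ⟨e.symm.trans e'⟩, fun ⟨e'⟩ => ⟨e.trans e'⟩⟩

theorem mult_iso (S : IndecReps C n) {X Y : C} (e : X ≅ Y) : mult S X = mult S Y := by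
  funext i
  obtain ⟨r, f, hf, ⟨d⟩⟩ := exists_sumDec X
  rw [mult_eq S d hf, mult_eq S (SumDec.ofIso e d) hf]

theorem mult_biprod (S : IndecReps C n) (X Y : C) : mult S (X ⊞ Y) = mult S X + mult S Y := by
  funext i
  obtain ⟨r, f, hf, ⟨d⟩⟩ := exists_sumDec X
  obtain ⟨t, g, hg, ⟨d'⟩⟩ := exists_sumDec Y
  rw [Pi.add_apply, mult_eq S d hf, mult_eq S d' hg, mult_eq S (d.sum d') (by
    rintro (w | w)
    · exact hf w
    · exact hg w), ← Nat.card_sum]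
  exact Nat.card_congr Equiv.subtypeSum

theorem mult_V (S : IndecReps C n) (j : Fin (n + 1)) : mult S (S.V j) = unitVec j := by
  funext i
  have d : SumDec (S.V j) (fun _ : Unit => S.V j) :=
    ⟨fun _ => 𝟙 _, fun _ => 𝟙 _, by simp, fun _ _ h => absurd rfl h, by simp⟩
  rw [mult_eq S d fun _ => S.indecomposable j]
  by_cases h : j = i
  · subst h
    have : Nonempty (S.V j ≅ S.V j) := ⟨Iso.refl _⟩
    simp [this]
  · have : IsEmpty {w : Unit // Nonempty (S.V j ≅ S.V i)} := ⟨fun w => h (S.eq_of_iso _ _ w.2)⟩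
    simp [Ne.symm h]

variable [MonoidalPreadditive C]

theorem cls_eq_sum (S : IndecReps C n) (X : C) : cls X = ∑ i, (mult S X i : ℤ) • cls (S.V i) := by
  obtain ⟨r, f, hf, ⟨d⟩⟩ := exists_sumDec X
  choose i e using fun k => S.exists_iso (f k) (hf k)
  have h (k : Fin r) (j : Fin (n + 1)) : Nonempty (f k ≅ S.V j) ↔ i k = j := by
    constructor
    · rintro ⟨e'⟩
      exact S.eq_of_iso _ _ ⟨(e k).some.symm.trans e'⟩
    · rintro rfl
      exact e k
  rw [cls_sumDec d, ← Finset.sum_fiberwise (s := Finset.univ) (g := i)]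
  refine Finset.sum_congr rfl fun j _ => ?_
  have h1 : mult S X j = (Finset.univ.filter fun k => i k = j).card := by
    rw [mult_eq S d hf]
    simp only [h]
    rw [Nat.card_eq_fintype_card, Fintype.card_subtype]
  rw [h1, natCast_zsmul, ← Finset.sum_const]
  refine Finset.sum_congr rfl fun k hk => ?_
  rw [Finset.mem_filter] at hk
  rw [← hk.2]
  exact cls_iso (e k).some

/-- The multiplicities as a function on isomorphism classes. -/
def multSkel (S : IndecReps C n) (x : Skeleton C) : Fin (n + 1) → ℤ :=
  Quotient.lift (s := isIsomorphicSetoid C) (fun X i => (mult S X i : ℤ))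
    (fun X Y h => by obtain ⟨e⟩ := h; rw [mult_iso S e]) x

/-- The multiplicities as an additive function on the free abelian group. -/
def multLift (S : IndecReps C n) : FreeAbelianGroup (Skeleton C) →+ (Fin (n + 1) → ℤ) :=
  FreeAbelianGroup.lift (multSkel S)

theorem multLift_of (S : IndecReps C n) (X : C) (i : Fin (n + 1)) :
    multLift S (FreeAbelianGroup.of (toSkeleton X)) i = mult S X i := by
  rw [multLift, FreeAbelianGroup.lift_apply_of]
  rfl

theorem multLift_eq_zero (S : IndecReps C n) {z : FreeAbelianGroup (Skeleton C)}
    (hz : z ∈ greenIdeal C) : multLift S z = 0 := by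
  change z ∈ AddSubgroup.closure (greenRel C) at hz
  have h : AddSubgroup.closure (greenRel C) ≤ (multLift S).ker := by
    rw [AddSubgroup.closure_le]
    rintro _ ⟨M, N, rfl⟩
    rw [SetLike.mem_coe, AddMonoidHom.mem_ker]
    funext i
    rw [map_sub, map_sub, Pi.sub_apply, Pi.sub_apply, multLift_of, multLift_of, multLift_of,
      mult_biprod]
    simp
  exact h hz

/-- The multiplicities as an additive function on the Green ring. -/
def multHom (S : IndecReps C n) : GreenRing C →+ (Fin (n + 1) → ℤ) :=
  (Ideal.Quotient.mk (greenIdeal C)).toAddMonoidHom.liftOfSurjective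
    Ideal.Quotient.mk_surjective ⟨multLift S, fun _ hz => multLift_eq_zero S
      (Ideal.Quotient.eq_zero_iff_mem.1 hz)⟩

theorem multHom_cls (S : IndecReps C n) (X : C) (i : Fin (n + 1)) :
    multHom S (cls X) i = mult S X i := by
  rw [← multLift_of]
  exact congrFun (AddMonoidHom.liftOfRightInverse_comp_apply _ _ _
    (⟨multLift S, fun _ hz => multLift_eq_zero S (Ideal.Quotient.eq_zero_iff_mem.1 hz)⟩ :
      {g : FreeAbelianGroup (Skeleton C) →+ (Fin (n + 1) → ℤ) //
        (Ideal.Quotient.mk (greenIdeal C)).toAddMonoidHom.ker ≤ g.ker})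
    (FreeAbelianGroup.of (toSkeleton X))) i

theorem green_induction {p : GreenRing C → Prop} (h0 : ∀ X : C, p (cls X))
    (hneg : ∀ a, p a → p (-a)) (hadd : ∀ a b, p a → p b → p (a + b)) (hz : p 0) (a) : p a := by
  obtain ⟨z, rfl⟩ := Ideal.Quotient.mk_surjective a
  induction z using FreeAbelianGroup.induction_on with
  | zero => rwa [map_zero]
  | of x =>
    obtain ⟨X, rfl⟩ := Quotient.exists_rep x
    exact h0 X
  | neg x hx => rw [map_neg]; exact hneg _ hx
  | add a b ha hb => rw [map_add]; exact hadd _ _ ha hb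

/-- The coordinates with respect to the classes of the indecomposable objects. -/
def greenEquiv (S : IndecReps C n) : GreenRing C ≃ₗ[ℤ] (Fin (n + 1) → ℤ) where
  toFun := multHom S
  map_add' := map_add _
  map_smul' a x := map_zsmul _ a x
  invFun v := ∑ i, v i • cls (S.V i)
  left_inv a := by
    induction a using green_induction with
    | h0 X => simp only [multHom_cls]; exact (cls_eq_sum S X).symm
    | hneg a ha => simpa using ha
    | hadd a b ha hb =>
      simp only [map_add, Pi.add_apply, add_smul, Finset.sum_add_distrib]
      exact congrArg₂ (· + ·) ha hb
    | hz => simp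
  right_inv v := by
    funext j
    rw [map_sum, Finset.sum_apply]
    simp only [map_zsmul, Pi.smul_apply, multHom_cls, mult_V]
    simp [Pi.single_apply]

theorem greenEquiv_symm_single (S : IndecReps C n) (i : Fin (n + 1)) :
    Module.Basis.ofEquivFun (greenEquiv S) i = cls (S.V i) := by
  rw [Module.Basis.coe_ofEquivFun]
  change ∑ j, (Pi.single i 1 : Fin (n + 1) → ℤ) j • cls (S.V j) = _
  simp [Pi.single_apply]

theorem greenEquiv_repr (S : IndecReps C n) (X : C) (i : Fin (n + 1)) :
    (Module.Basis.ofEquivFun (greenEquiv S)).repr (cls X) i = mult S X i :=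
  multHom_cls S X i

/-- The classes `[V i]` form a `ℤ₊`-basis of the Green ring. -/
def greenBasis (S : IndecReps C n) : ZPlusBasis (GreenRing C) n where
  basis := Module.Basis.ofEquivFun (greenEquiv S)
  nonneg i j k := by
    rw [greenEquiv_symm_single, greenEquiv_symm_single, cls_mul, greenEquiv_repr]
    exact Int.natCast_nonneg _
  unital := by
    rw [greenEquiv_symm_single, S.V_zero, cls_unit]

theorem greenBasis_basis (S : IndecReps C n) (i : Fin (n + 1)) :
    (greenBasis S).basis i = cls (S.V i) := greenEquiv_symm_single S i

end GreenBasis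

/-! ### The quadruple of a tensor category -/

section Data

variable (𝕜 : Type*) [Field 𝕜] {C : Type u} [Category.{v} C] [Preadditive C] [Linear 𝕜 C]
  [HasFiniteBiproducts C] [HasBinaryBiproducts C]

section Linear

variable {n : ℕ} (V : Fin (n + 1) → C)

/-- The idempotents `e_i = τ_i π_i` of `End (⨁ V_i)`. -/
def idemFamily : IdemFamily 𝕜 (End (⨁ V)) n where
  e i := (biproduct.π V i ≫ biproduct.ι V i : ⨁ V ⟶ ⨁ V)
  complete :=
    { idem := fun i => by
        change (biproduct.π V i ≫ biproduct.ι V i) ≫ biproduct.π V i ≫ biproduct.ι V i = _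
        simp
      ortho := fun i j h => by
        change (biproduct.π V j ≫ biproduct.ι V j) ≫ biproduct.π V i ≫ biproduct.ι V i = 0
        rw [Category.assoc, ← Category.assoc (biproduct.ι V j), biproduct.ι_π_ne V h.symm]
        simp
      complete := biproduct.total }

/-- The object `V^{(m)} = ⨁ᵢ mᵢ Vᵢ`. -/
abbrev powObj (m : Fin (n + 1) → ℕ) : C := ⨁ fun p : Idx m => V p.1

variable {𝕜 V}

/-- An entry of a matrix over `End (⨁ V_i)` as a morphism. -/
def entry {m s : Hat (idemFamily 𝕜 V)} (X : m ⟶ s) (p : Idx s.mult) (q : Idx m.mult) : ⨁ V ⟶ ⨁ V :=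
  (Hat.mat X p q : End (⨁ V))

/-- The morphism `V^{(m)} ⟶ V^{(s)}` with given `(s, m)`-type matrix. -/
def ofMat {m s : Hat (idemFamily 𝕜 V)} (X : m ⟶ s) : powObj V m.mult ⟶ powObj V s.mult :=
  biproduct.matrix fun q p => biproduct.ι V q.1 ≫ entry X p q ≫ biproduct.π V p.1

/-- The `(s, m)`-type matrix of a morphism `V^{(m)} ⟶ V^{(s)}`. -/
def toMat {m s : Hat (idemFamily 𝕜 V)} (f : powObj V m.mult ⟶ powObj V s.mult) : m ⟶ s :=
  ⟨fun p q => (biproduct.π V q.1 ≫ (biproduct.ι (fun q : Idx m.mult => V q.1) q ≫ f ≫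
    biproduct.π (fun p : Idx s.mult => V p.1) p) ≫ biproduct.ι V p.1 : ⨁ V ⟶ ⨁ V), fun p q => by
    change (biproduct.π V q.1 ≫ biproduct.ι V q.1) ≫ (biproduct.π V q.1 ≫ _ ≫ biproduct.ι V p.1) ≫
      (biproduct.π V p.1 ≫ biproduct.ι V p.1) = _
    simp⟩

theorem entry_toMat {m s : Hat (idemFamily 𝕜 V)} (f : powObj V m.mult ⟶ powObj V s.mult) (p q) :
    entry (toMat f : m ⟶ s) p q = (biproduct.π V q.1 ≫ (biproduct.ι (fun q : Idx m.mult => V q.1) q ≫ f ≫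
      biproduct.π (fun p : Idx s.mult => V p.1) p) ≫ biproduct.ι V p.1 : ⨁ V ⟶ ⨁ V) := rfl

theorem mat_toMat {m s : Hat (idemFamily 𝕜 V)} (f : powObj V m.mult ⟶ powObj V s.mult) (p q) :
    Hat.mat (toMat f : m ⟶ s) p q = (biproduct.π V q.1 ≫ (biproduct.ι (fun q : Idx m.mult => V q.1) q ≫
      f ≫ biproduct.π (fun p : Idx s.mult => V p.1) p) ≫ biproduct.ι V p.1 : ⨁ V ⟶ ⨁ V) := rfl

theorem ofMat_toMat {m s : Hat (idemFamily 𝕜 V)} (f : powObj V m.mult ⟶ powObj V s.mult) :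
    ofMat (toMat f) = f := by
  refine biproduct.hom_ext' _ _ fun q => biproduct.hom_ext _ _ fun p => ?_
  rw [ofMat]
  simp [entry_toMat]

theorem toMat_ofMat {m s : Hat (idemFamily 𝕜 V)} (X : m ⟶ s) : toMat (ofMat X) = X := by
  refine Hat.hom_ext fun p q => ?_
  change entry (toMat (ofMat X) : m ⟶ s) p q = entry X p q
  have h : (biproduct.π V q.1 ≫ biproduct.ι V q.1) ≫ entry X p q ≫
      (biproduct.π V p.1 ≫ biproduct.ι V p.1) = entry X p q := X.2 p q
  rw [entry_toMat, ofMat]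
  simpa using h

theorem toMat_comp {m s t : Hat (idemFamily 𝕜 V)} (f : powObj V m.mult ⟶ powObj V s.mult)
    (g : powObj V s.mult ⟶ powObj V t.mult) :
    (toMat (f ≫ g) : m ⟶ t) = (toMat f : m ⟶ s) ≫ (toMat g : s ⟶ t) := by
  apply Hat.hom_ext
  intro p q
  rw [Hat.mat_comp, Matrix.mul_apply, mat_toMat]
  change _ = ∑ r : Idx s.mult, entry (toMat f : m ⟶ s) r q ≫ entry (toMat g : s ⟶ t) p r
  simp only [entry_toMat]
  have h : f ≫ g = f ≫ (∑ r : Idx s.mult, biproduct.π (fun p : Idx s.mult => V p.1) r ≫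
    biproduct.ι (fun p : Idx s.mult => V p.1) r) ≫ g := by rw [biproduct.total, Category.id_comp]
  rw [h]
  simp only [Preadditive.comp_sum, Preadditive.sum_comp, Category.assoc,
    biproduct.ι_π_self_assoc]

theorem toMat_id (m : Hat (idemFamily 𝕜 V)) : toMat (𝟙 (powObj V m.mult)) = 𝟙 m := by
  apply Hat.hom_ext
  intro p q
  rw [Hat.mat_id, mat_toMat]
  by_cases h : p = q
  · subst h
    rw [Matrix.diagonal_apply_eq, Category.id_comp, biproduct.ι_π_self, Category.id_comp]
    rfl
  · rw [Matrix.diagonal_apply_ne _ h, Category.id_comp, biproduct.ι_π_ne _ (Ne.symm h)]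
    simp

theorem toMat_add {m s : Hat (idemFamily 𝕜 V)} (f g : powObj V m.mult ⟶ powObj V s.mult) :
    (toMat (f + g) : m ⟶ s) = toMat f + toMat g := by
  apply Hat.hom_ext
  intro p q
  rw [Hat.mat_add, Matrix.add_apply, mat_toMat, mat_toMat, mat_toMat]
  simp

theorem toMat_smul {m s : Hat (idemFamily 𝕜 V)} (a : 𝕜) (f : powObj V m.mult ⟶ powObj V s.mult) :
    (toMat (a • f) : m ⟶ s) = a • toMat f := by
  apply Hat.hom_ext
  intro p q
  rw [Hat.mat_smul, Matrix.smul_apply, mat_toMat, mat_toMat]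
  simp

theorem toMat_sum {ι : Type*} (t : Finset ι) {m s : Hat (idemFamily 𝕜 V)}
    (f : ι → (powObj V m.mult ⟶ powObj V s.mult)) :
    (toMat (∑ i ∈ t, f i) : m ⟶ s) = ∑ i ∈ t, toMat (f i) :=
  map_sum (AddMonoidHom.mk' (fun f => (toMat f : m ⟶ s)) toMat_add) f t

theorem toMat_zero (m s : Hat (idemFamily 𝕜 V)) :
    (toMat (0 : powObj V m.mult ⟶ powObj V s.mult) : m ⟶ s) = 0 :=
  map_zero (AddMonoidHom.mk' (fun f => (toMat f : m ⟶ s)) toMat_add)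

theorem ofMat_comp {m s t : Hat (idemFamily 𝕜 V)} (X : m ⟶ s) (Y : s ⟶ t) :
    ofMat (X ≫ Y) = ofMat X ≫ ofMat Y := by
  conv_lhs => rw [← toMat_ofMat X, ← toMat_ofMat Y, ← toMat_comp, ofMat_toMat]

theorem ofMat_id (m : Hat (idemFamily 𝕜 V)) : ofMat (𝟙 m) = 𝟙 (powObj V m.mult) := by
  rw [← toMat_id, ofMat_toMat]

theorem ofMat_add {m s : Hat (idemFamily 𝕜 V)} (X Y : m ⟶ s) :
    ofMat (X + Y) = ofMat X + ofMat Y := by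
  conv_lhs => rw [← toMat_ofMat X, ← toMat_ofMat Y, ← toMat_add, ofMat_toMat]

theorem ofMat_sum {ι : Type*} (t : Finset ι) {m s : Hat (idemFamily 𝕜 V)} (X : ι → (m ⟶ s)) :
    ofMat (∑ i ∈ t, X i) = ∑ i ∈ t, ofMat (X i) :=
  map_sum (AddMonoidHom.mk' (fun X : m ⟶ s => ofMat X) ofMat_add) X t

theorem ofMat_zero (m s : Hat (idemFamily 𝕜 V)) : ofMat (0 : m ⟶ s) = 0 :=
  map_zero (AddMonoidHom.mk' (fun X : m ⟶ s => ofMat X) ofMat_add)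

/-- The isomorphism of `Ĉ` given by an isomorphism `V^{(m)} ≅ V^{(s)}`. -/
def toMatIso {m s : Hat (idemFamily 𝕜 V)} (f : powObj V m.mult ≅ powObj V s.mult) : m ≅ s where
  hom := toMat f.hom
  inv := toMat f.inv
  hom_inv_id := by rw [← toMat_comp, f.hom_inv_id, toMat_id]
  inv_hom_id := by rw [← toMat_comp, f.inv_hom_id, toMat_id]

/-- The image in `C` of a direct sum decomposition in `Ĉ`. -/
def ofMatDec {W : Type} [Fintype W] {m : Hat (idemFamily 𝕜 V)} {U : W → Hat (idemFamily 𝕜 V)}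
    (d : SumDec m U) : SumDec (powObj V m.mult) (fun w => powObj V (U w).mult) where
  inc w := ofMat (d.inc w)
  prj w := ofMat (d.prj w)
  inc_prj w := by rw [← ofMat_comp, d.inc_prj, ofMat_id]
  inc_prj_ne w w' h := by rw [← ofMat_comp, d.inc_prj_ne w w' h, ofMat_zero]
  total := by
    rw [← ofMat_id, ← d.total, ofMat_sum]
    exact Finset.sum_congr rfl fun w _ => (ofMat_comp _ _).symm

variable {P : C} {c : Fin (n + 1) → Fin (n + 1) → Fin (n + 1) → ℕ}
  (d : SumDec P fun x : Fin (n + 1) × Fin (n + 1) => powObj V (c x.1 x.2))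

variable (𝕜) in
/-- The matrix of a component of an endomorphism of `P = ⨁ V^{(c_{ij})}`. -/
def endBlock (f : P ⟶ P) (y x : Fin (n + 1) × Fin (n + 1)) :
    (⟨c y.1 y.2⟩ : Hat (idemFamily 𝕜 V)) ⟶ ⟨c x.1 x.2⟩ :=
  toMat (d.inc y ≫ f ≫ d.prj x)

theorem endBlock_add (f g : P ⟶ P) (y x) :
    endBlock 𝕜 d (f + g) y x = endBlock 𝕜 d f y x + endBlock 𝕜 d g y x := by
  rw [endBlock, endBlock, endBlock, ← toMat_add]
  simp

theorem endBlock_smul (a : 𝕜) (f : P ⟶ P) (y x) :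
    endBlock 𝕜 d (a • f) y x = a • endBlock 𝕜 d f y x := by
  rw [endBlock, endBlock, ← toMat_smul]
  simp

theorem endBlock_id_self (x) : endBlock 𝕜 d (𝟙 P) x x = 𝟙 _ := by
  rw [endBlock, Category.id_comp, d.inc_prj]
  exact toMat_id _

theorem endBlock_id_ne {y x} (h : y ≠ x) : endBlock 𝕜 d (𝟙 P) y x = 0 := by
  rw [endBlock, Category.id_comp, d.inc_prj_ne _ _ h]
  exact toMat_zero _ _

theorem endBlock_comp (f g : P ⟶ P) (y x) :
    endBlock 𝕜 d (f ≫ g) y x = ∑ z, endBlock 𝕜 d f y z ≫ endBlock 𝕜 d g z x := by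
  simp only [endBlock, ← toMat_comp, ← toMat_sum]
  have h : f ≫ g = f ≫ (∑ z, d.prj z ≫ d.inc z) ≫ g := by rw [d.total, Category.id_comp]
  rw [h]
  simp only [Preadditive.comp_sum, Preadditive.sum_comp, Category.assoc]

theorem endBlock_prj_inc (w y x : Fin (n + 1) × Fin (n + 1)) :
    endBlock 𝕜 d (d.prj w ≫ d.inc w) y x = (MAlg.unit (idemFamily 𝕜 V) c w).toHom y x := by
  have h : endBlock 𝕜 d (d.prj w ≫ d.inc w) y x =
      toMat ((d.inc y ≫ d.prj w) ≫ d.inc w ≫ d.prj x) := by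
    rw [endBlock]; simp only [Category.assoc]
  rw [h]
  by_cases hy : y = w
  · subst hy
    by_cases hx : x = y
    · subst hx
      rw [d.inc_prj, Category.id_comp]
      exact (toMat_id _).trans (MAlg.unit_self x).symm
    · rw [d.inc_prj_ne _ _ (Ne.symm hx), comp_zero]
      exact (toMat_zero _ _).trans (MAlg.unit_ne _ _ _ fun h => hx h.2).symm
  · rw [d.inc_prj_ne _ _ hy, zero_comp]
    exact (toMat_zero _ _).trans (MAlg.unit_ne _ _ _ fun h => hy h.1).symm

variable (𝕜) in
/-- For a decomposition `P = ⨁ V^{(c_{ij})}`, the algebra map from `End P` to `M(R, A, I)` that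
sends an endomorphism to the matrices of its components. -/
def endToMAlg : End P →ₐ[𝕜] MAlg (idemFamily 𝕜 V) c :=
  AlgHom.ofLinearMap
    { toFun := fun f => (endBlock 𝕜 d f :
        Mat_.Hom (cFamily (idemFamily 𝕜 V) c) (cFamily (idemFamily 𝕜 V) c))
      map_add' := fun f g => by
        funext y x
        exact endBlock_add d f g y x
      map_smul' := fun a f => by
        funext y x
        exact endBlock_smul d a f y x }
    (by
      funext y x
      by_cases h : y = x
      · subst h
        exact (endBlock_id_self d y).trans (Mat_.id_apply_self (cFamily (idemFamily 𝕜 V) c) y).symm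
      · exact (endBlock_id_ne d h).trans (Mat_.id_apply_of_ne (cFamily (idemFamily 𝕜 V) c) y x h).symm)
    (fun f g => by
      funext y x
      exact endBlock_comp d g f y x)

end Linear

section Tensor

variable [MonoidalCategory C] [MonoidalPreadditive C]

/-- The tensor product of two direct sums in `C`. -/
def SumDec.tensor {W W' : Type} [Fintype W] [Fintype W'] {P P' : C} {U : W → C} {U' : W' → C}
    (d : SumDec P U) (d' : SumDec P' U') :
    SumDec (P ⊗ P') (fun w : W × W' => U w.1 ⊗ U' w.2) where
  inc w := d.inc w.1 ⊗ₘ d'.inc w.2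
  prj w := d.prj w.1 ⊗ₘ d'.prj w.2
  inc_prj w := by rw [tensorHom_comp_tensorHom, d.inc_prj, d'.inc_prj, id_tensorHom_id]
  inc_prj_ne w w' h := by
    rw [tensorHom_comp_tensorHom]
    by_cases h1 : w.1 = w'.1
    · have h2 : w.2 ≠ w'.2 := fun h2 => h (Prod.ext h1 h2)
      rw [d'.inc_prj_ne _ _ h2, MonoidalPreadditive.tensor_zero]
    · rw [d.inc_prj_ne _ _ h1, MonoidalPreadditive.zero_tensor]
  total := by
    rw [← id_tensorHom_id, ← d.total, ← d'.total, sum_tensor, Fintype.sum_prod_type]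
    refine Finset.sum_congr rfl fun p _ => ?_
    rw [tensor_sum]
    exact Finset.sum_congr rfl fun q _ => tensorHom_comp_tensorHom _ _ _ _

/-- Composition of a direct sum decomposition with isomorphisms of the summands. -/
def SumDec.congr {W : Type} [Fintype W] {P : C} {U U' : W → C} (d : SumDec P U)
    (g : ∀ w, U w ≅ U' w) : SumDec P U' where
  inc w := (g w).inv ≫ d.inc w
  prj w := d.prj w ≫ (g w).hom
  inc_prj w := by
    rw [Category.assoc, ← Category.assoc (d.inc w), d.inc_prj, Category.id_comp, Iso.inv_hom_id]
  inc_prj_ne w w' h := by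
    rw [Category.assoc, ← Category.assoc (d.inc w), d.inc_prj_ne w w' h]
    simp
  total := by simpa using d.total

variable [MonoidalLinear 𝕜 C]

/-- The algebra map `End X ⊗ End Y → End (X ⊗ Y)`, `x ⊗ y ↦ x ⊗ y`. -/
def tensorEnd (X Y : C) : End X ⊗[𝕜] End Y →ₐ[𝕜] End (X ⊗ Y) :=
  Algebra.TensorProduct.lift
    (AlgHom.ofLinearMap
      { toFun := fun x => ((x : X ⟶ X) ▷ Y : X ⊗ Y ⟶ X ⊗ Y)
        map_add' := fun x x' => MonoidalPreadditive.add_whiskerRight (x : X ⟶ X) (x' : X ⟶ X)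
        map_smul' := fun a x => MonoidalLinear.smul_whiskerRight a (x : X ⟶ X) Y }
      (id_whiskerRight X Y)
      (fun x x' => comp_whiskerRight (x' : X ⟶ X) (x : X ⟶ X) Y))
    (AlgHom.ofLinearMap
      { toFun := fun y => (X ◁ (y : Y ⟶ Y) : X ⊗ Y ⟶ X ⊗ Y)
        map_add' := fun y y' => MonoidalPreadditive.whiskerLeft_add (y : Y ⟶ Y) (y' : Y ⟶ Y)
        map_smul' := fun a y => MonoidalLinear.whiskerLeft_smul X a (y : Y ⟶ Y) }
      (whiskerLeft_id X Y)
      (fun y y' => whiskerLeft_comp X (y' : Y ⟶ Y) (y : Y ⟶ Y)))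
    (fun x y => whisker_exchange (x : X ⟶ X) (y : Y ⟶ Y))

theorem tensorEnd_tmul (X Y : C) (x : X ⟶ X) (y : Y ⟶ Y) :
    tensorEnd 𝕜 X Y ((x : End X) ⊗ₜ (y : End Y)) = (x ⊗ₘ y : X ⊗ Y ⟶ X ⊗ Y) := by
  refine Eq.trans ?_ (tensorHom_def' x y).symm
  exact Algebra.TensorProduct.lift_tmul (A := End X) (B := End Y) _ _ _ x y

variable [IsKrullSchmidt C] {n : ℕ}

/-- Isomorphisms `θ_{ij} : V_i ⊗ V_j ≅ ⨁ₖ c_{ijk} V_k`, where `θ_{0i}` and `θ_{i0}` are the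
identities of `V_i`, up to the unit constraints of `C`. -/
structure FusionIsos (S : IndecReps C n) where
  iso : ∀ i j, S.V i ⊗ S.V j ≅ powObj S.V ((greenBasis S).c i j)
  zero_left : ∀ i, (iso 0 i).hom = eqToHom S.V_zero ▷ S.V i ≫ (λ_ (S.V i)).hom ≫
    biproduct.ι (fun p : Idx ((greenBasis S).c 0 i) => S.V p.1)
      ⟨i, ⟨0, by rw [(greenBasis S).c_zero_left]; simp⟩⟩
  zero_right : ∀ i, (iso i 0).hom = S.V i ◁ eqToHom S.V_zero ≫ (ρ_ (S.V i)).hom ≫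
    biproduct.ι (fun p : Idx ((greenBasis S).c i 0) => S.V p.1)
      ⟨i, ⟨0, by rw [(greenBasis S).c_zero_right]; simp⟩⟩

namespace FusionIsos

variable {S : IndecReps C n} (θ : FusionIsos S)

/-- The decomposition of `V ⊗ V`, `V = ⨁ V_i`, given by the morphisms `θ_{ij} (π_i ⊗ π_j)` and
`(τ_i ⊗ τ_j) θ_{ij}⁻¹`. -/
def dec : SumDec ((⨁ S.V) ⊗ (⨁ S.V)) fun x : Fin (n + 1) × Fin (n + 1) =>
    powObj S.V ((greenBasis S).c x.1 x.2) :=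
  ((biproductDec S.V).tensor (biproductDec S.V)).congr fun x => θ.iso x.1 x.2

/-- The algebra map `φ_C : A(C) ⊗ A(C) → M(C)`, for the Auslander algebra `A(C) = End (⨁ V_i)`: the
component of `φ_C (x ⊗ y)` from `(i, j)` to `(i', j')` is the matrix of
`θ_{i'j'} (π_{i'} ⊗ π_{j'}) (x ⊗ y) (τ_i ⊗ τ_j) θ_{ij}⁻¹`. -/
def φ : TensorMap (idemFamily 𝕜 S.V) (greenBasis S).c where
  toAlgHom := (endToMAlg 𝕜 θ.dec).comp (tensorEnd 𝕜 _ _)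
  map_idem i j := by
    have h : tensorEnd 𝕜 _ _ ((idemFamily 𝕜 S.V).e i ⊗ₜ (idemFamily 𝕜 S.V).e j) =
        (θ.dec.prj (i, j) ≫ θ.dec.inc (i, j) : (⨁ S.V) ⊗ (⨁ S.V) ⟶ (⨁ S.V) ⊗ (⨁ S.V)) := by
      refine (tensorEnd_tmul 𝕜 _ _ _ _).trans ((tensorHom_comp_tensorHom (biproduct.π S.V i)
        (biproduct.π S.V j) (biproduct.ι S.V i) (biproduct.ι S.V j)).symm.trans ?_)
      change _ = (((biproductDec S.V).tensor (biproductDec S.V)).prj (i, j) ≫ (θ.iso i j).hom) ≫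
        (θ.iso i j).inv ≫ ((biproductDec S.V).tensor (biproductDec S.V)).inc (i, j)
      rw [Category.assoc, Iso.hom_inv_id_assoc]
      rfl
    rw [AlgHom.comp_apply, h]
    funext y x
    exact endBlock_prj_inc θ.dec (i, j) y x

/-- The isomorphism `θ(m, s) : V^{(m)} ⊗ V^{(s)} ≅ V^{(m ⊗̂ s)}`, whose underlying morphism is
`∑ (X_p ⊗̂ X_q) θ_{ij} (Y_p ⊗ Y_q)`, with `p, q` running over the rows of type `m, s` and `i, j` their
blocks. -/
def total (m s : Hat (idemFamily 𝕜 S.V)) :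
    powObj S.V m.mult ⊗ powObj S.V s.mult ≅ powObj S.V (Hat.tensor (greenBasis S).c m s).mult :=
  SumDec.mapIso
    ((biproductDec fun p : Idx m.mult => S.V p.1).tensor (biproductDec fun q : Idx s.mult => S.V q.1))
    (ofMatDec ((θ.φ 𝕜).sumDec m.dec s.dec))
    fun w => (θ.iso w.1.1 w.2.1).trans
      (eqToIso (congrArg (powObj S.V) (tens_unit_unit (greenBasis S).c w.1.1 w.2.1).symm))

/-- The matrix
`a_{ijl} = θ(e_i, e_j ⊗̂ e_l) (E ⊗ θ(e_j, e_l)) (θ(e_i, e_j)⁻¹ ⊗ E) θ(e_i ⊗̂ e_j, e_l)⁻¹`, with the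
associativity constraint of `C` in the middle. -/
def assoc (i j l : Fin (n + 1)) :
    Hat.tensor (greenBasis S).c (Hat.tensor (greenBasis S).c (Hat.single (idemFamily 𝕜 S.V) i)
      (Hat.single _ j)) (Hat.single _ l) ≅
    Hat.tensor (greenBasis S).c (Hat.single (idemFamily 𝕜 S.V) i)
      (Hat.tensor (greenBasis S).c (Hat.single _ j) (Hat.single _ l)) :=
  toMatIso <|
    (θ.total 𝕜 (Hat.tensor _ (Hat.single _ i) (Hat.single _ j)) (Hat.single _ l)).symm ≪≫
    whiskerRightIso (θ.total 𝕜 (Hat.single _ i) (Hat.single _ j)).symm _ ≪≫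
    α_ _ _ _ ≪≫
    whiskerLeftIso _ (θ.total 𝕜 (Hat.single _ j) (Hat.single _ l)) ≪≫
    θ.total 𝕜 (Hat.single _ i) (Hat.tensor _ (Hat.single _ j) (Hat.single _ l))

/-- The quadruple `(r(C), A(C), φ_C, {a_{ijl}})`. -/
def quadruple : Quadruple 𝕜 (GreenRing C) (End (⨁ S.V)) n where
  basis := greenBasis S
  idem := idemFamily 𝕜 S.V
  φ := θ.φ 𝕜
  a := θ.assoc 𝕜

end FusionIsos

end Tensor

end Data

/-- Tensor equivalence of `𝕜`-linear monoidal categories: there is a `𝕜`-linear strong monoidal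
functor that is an equivalence of categories. -/
def TensorEquivalent (𝕜 : Type*) [Field 𝕜] (C : Type*) [Category* C] [Preadditive C] [Linear 𝕜 C]
    [MonoidalCategory C] (D : Type*) [Category* D] [Preadditive D] [Linear 𝕜 D]
    [MonoidalCategory D] : Prop :=
  ∃ (F : C ⥤ D) (_ : F.Additive), F.Linear 𝕜 ∧ F.IsEquivalence ∧ Nonempty F.Monoidal

instance (priority := 100) abelian_hasFiniteBiproducts (C : Type u) [Category.{v} C] [Abelian C] :
    HasFiniteBiproducts C := Abelian.hasFiniteBiproducts

end TensorRecon

end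

open TensorRecon

/-! The category `Ĉ` is `C` written in coordinates. Sending `m` to `V^{(m)}`, and a typed matrix to
the morphism of which it is the matrix, gives a fully faithful `𝕜`-linear functor `Ĉ ⥤ C`. It is
essentially surjective because every object decomposes into copies of the `V_i`
(`nonempty_iso_powObj`). It remains to see that the tensor structure read off from the quadruple is
the one that `C` induces on `Ĉ` through the isomorphisms `θ(m, s)`.

On morphisms this is the naturality of `θ(m, s)` (`total_natural`). Between two pairs of summands it
reduces to the definition of `φ` as conjugation by the `θ_{ij}`. The associator of `C`, transported
along `θ`, is natural as well, so it is determined by its values at triples of unit vectors. These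
are the matrices `a_{ijl}`, and the sum over triples of rows rebuilds the whole constraint from them
(`ofMat_quadruple_assoc`). The unit constraints can be identities for two reasons: `θ_{0i}` and
`θ_{i0}` are normalized, and concatenation with a unit factor does not permute rows
(`total_leftUnitor`, `total_rightUnitor`). A faithful functor that matches all these data reflects
the axioms of a monoidal category, and it is strong monoidal for the structure so obtained.

The isomorphisms `θ_{ij}` exist because the structure constants of the Green ring are the
multiplicities of the `V_k` in `V_i ⊗ V_j`. The two normalizations overlap only at `(0, 0)`, where
they agree since `λ_𝟙 = ρ_𝟙`.

For the second statement, a ring isomorphism that respects the bases forces equal structure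
constants, hence the same objects, matrix shapes and concatenations. Applying `δ` to entries is then
an equivalence between the two matrix categories that preserves tensor products and constraints
strictly. Composing with the equivalences to `C` and `C'` gives the result. -/

noncomputable section

namespace TensorRecon

/-! ### Row positions in a concatenation -/

section Positions

variable {n : ℕ}

/-- The index of a matrix of type `s` with the same block and position as an index of type `m = s`. -/
def castIdx {m s : Fin (n + 1) → ℕ} (h : m = s) (p : Idx m) : Idx s :=
  ⟨p.1, Fin.cast (congrFun h p.1) p.2⟩

theorem castIdx_rfl {m : Fin (n + 1) → ℕ} (p : Idx m) : castIdx rfl p = p := rfl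

variable {c : Fin (n + 1) → Fin (n + 1) → Fin (n + 1) → ℕ} {m s : Fin (n + 1) → ℕ}

/-- A finite linear order has only one increasing enumeration, and a strictly increasing map from
`Fin N` into an order with `N` elements is bijective. Any explicit increasing list of the positions
therefore computes `posEquiv`. -/
theorem posEquiv_eq_of_strictMono {k : Fin (n + 1)} {N : ℕ} (hN : tens c m s k = N)
    {f : Fin N → Pos c m s k} (hf : StrictMono f) (u : Fin (tens c m s k)) :
    posEquiv c m s k u = f (Fin.cast hN u) := by
  subst hN
  have hb : Function.Bijective f :=
    (Fintype.bijective_iff_injective_and_card f).2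
      ⟨hf.injective, by rw [Fintype.card_fin, card_pos]⟩
  exact congrArg (fun e : Fin (tens c m s k) ≃o Pos c m s k => e u)
    (Subsingleton.elim (posEquiv c m s k) (hf.orderIsoOfSurjective f hb.2))

/-- Each unit vector has a single row, so the four outer coordinates of a position are forced. Only
the row of the inserted matrix varies, and the enumeration follows it. -/
theorem splitIdx_single (i j : Fin (n + 1)) (P : Idx (tens c (unitVec i) (unitVec j))) :
    splitIdx c (unitVec i) (unitVec j) P =
      ⟨(⟨i, ⟨0, by simp⟩⟩, ⟨j, ⟨0, by simp⟩⟩), castIdx (tens_unit_unit c i j) P⟩ := by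
  obtain ⟨k, u⟩ := P
  let f : Fin (c i j k) → Pos c (unitVec i) (unitVec j) k := fun t =>
    toLex ⟨j, toLex ⟨⟨0, by simp⟩, toLex ⟨i, toLex ⟨⟨0, by simp⟩, t⟩⟩⟩⟩
  have hf : StrictMono f := fun t t' h =>
    Sigma.Lex.right _ _ (Sigma.Lex.right _ _ (Sigma.Lex.right _ _ (Sigma.Lex.right _ _ h)))
  change Pos.unpack (posEquiv c _ _ k u) = _
  rw [posEquiv_eq_of_strictMono (congrFun (tens_unit_unit c i j) k) hf]
  rfl

/-- Since `c 0 j = unitVec j`, block `k` receives rows only from `j = k`, one for each row of `m` in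
that block. The only free coordinate is the row of `m`, so concatenation leaves the order unchanged.
This is what permits identities as unit constraints. -/
theorem splitIdx_unit_left (hc : ∀ i, c 0 i = unitVec i) (h : tens c (unitVec 0) m = m)
    (P : Idx m) :
    splitIdx c (unitVec 0) m (castIdx h.symm P) =
      ⟨(⟨0, ⟨0, by simp⟩⟩, P), ⟨P.1, ⟨0, by simp [hc]⟩⟩⟩ := by
  obtain ⟨k, u⟩ := P
  let f : Fin (m k) → Pos c (unitVec 0) m k := fun t =>
    toLex ⟨k, toLex ⟨t, toLex ⟨0, toLex ⟨⟨0, by simp⟩, ⟨0, by simp [hc]⟩⟩⟩⟩⟩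
  have hf : StrictMono f := fun t t' h => Sigma.Lex.right _ _ (Sigma.Lex.left _ _ h)
  change Pos.unpack (posEquiv c _ _ k (Fin.cast (congrFun h.symm k) u)) = _
  rw [posEquiv_eq_of_strictMono (congrFun h k) hf]
  rfl

theorem splitIdx_unit_right (hc : ∀ i, c i 0 = unitVec i) (h : tens c m (unitVec 0) = m)
    (P : Idx m) :
    splitIdx c m (unitVec 0) (castIdx h.symm P) =
      ⟨(P, ⟨0, ⟨0, by simp⟩⟩), ⟨P.1, ⟨0, by simp [hc]⟩⟩⟩ := by
  obtain ⟨k, u⟩ := P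
  let f : Fin (m k) → Pos c m (unitVec 0) k := fun t =>
    toLex ⟨0, toLex ⟨⟨0, by simp⟩, toLex ⟨k, toLex ⟨t, ⟨0, by simp [hc]⟩⟩⟩⟩⟩
  have hf : StrictMono f := fun t t' h =>
    Sigma.Lex.right _ _ (Sigma.Lex.right _ _ (Sigma.Lex.right _ _ (Sigma.Lex.left _ _ h)))
  change Pos.unpack (posEquiv c _ _ k (Fin.cast (congrFun h.symm k) u)) = _
  rw [posEquiv_eq_of_strictMono (congrFun h k) hf]
  rfl

end Positions

/-! ### Entries of tensor products of typed matrices -/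

section Hat

variable {𝕜 A : Type*} [Field 𝕜] [Ring A] [Algebra 𝕜 A] {n : ℕ} {E : IdemFamily 𝕜 A n}

theorem Hat.mat_comp_eqToHom {m s t : Hat E} (f : m ⟶ s) (h : s = t) (p q) :
    Hat.mat (f ≫ eqToHom h) p q = Hat.mat f (castIdx (congrArg Hat.mult h.symm) p) q := by
  subst h
  rw [eqToHom_refl, Category.comp_id, castIdx_rfl]

theorem Hat.mat_eqToHom_comp {m s t : Hat E} (h : m = s) (f : s ⟶ t) (p q) :
    Hat.mat (eqToHom h ≫ f) p q = Hat.mat f p (castIdx (congrArg Hat.mult h) q) := by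
  subst h
  rw [eqToHom_refl, Category.id_comp, castIdx_rfl]

/-- Cutting a matrix down by an insertion and a projection isolates one entry as a `1 × 1` matrix.
The indices `w`, `w'` are free because unit types have only one row. -/
theorem Hat.mat_ins_comp_prj {m s : Hat E} (X : m ⟶ s) (q : Idx m.mult) (p : Idx s.mult) (w w') :
    Hat.mat (Hat.ins m q ≫ X ≫ Hat.prj s p) w w' = Hat.mat X p q := by
  rw [Hat.mat_comp, Hat.mat_comp, Matrix.mul_apply, Finset.sum_eq_single q]
  · rw [Matrix.mul_apply, Finset.sum_eq_single p]
    · rw [Hat.mat_ins, Hat.mat_prj, if_pos rfl, if_pos rfl, Hat.left_mat, Hat.mat_right]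
    · intro p' _ h
      rw [Hat.mat_prj, if_neg h, zero_mul]
    · simp
  · intro q' _ h
    rw [Hat.mat_ins, if_neg h, mul_zero]
  · simp

variable {c : Fin (n + 1) → Fin (n + 1) → Fin (n + 1) → ℕ}

theorem Hat.tensor_single (i j : Fin (n + 1)) :
    Hat.tensor c (Hat.single E i) (Hat.single E j) = ⟨c i j⟩ :=
  Hat.ext (tens_unit_unit c i j)

namespace TensorMap

variable (φ : TensorMap E c)

/-- The component of `φ (x ⊗ y)` as a morphism `c_{ij} ⟶ c_{i'j'}`. -/
def comp (x y : A) (i j i' j' : Fin (n + 1)) : (⟨c i j⟩ : Hat E) ⟶ ⟨c i' j'⟩ :=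
  (φ.toAlgHom (x ⊗ₜ y)).toHom (i, j) (i', j')

/-- The entry of `X ⊗̂ Y` whose row and column are given by pairs of rows and columns of `X, Y`
together with a row and a column of the inserted matrix. -/
def tensorEntry {m₁ s₁ m₂ s₂ : Hat E} (X : m₁ ⟶ s₁) (Y : m₂ ⟶ s₂)
    (x : Σ w : Idx s₁.mult × Idx s₂.mult, Idx (c w.1.1 w.2.1))
    (y : Σ w : Idx m₁.mult × Idx m₂.mult, Idx (c w.1.1 w.2.1)) : A :=
  (φ.toAlgHom (Hat.mat X x.1.1 y.1.1 ⊗ₜ Hat.mat Y x.1.2 y.1.2)).block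
    (x.1.1.1, x.1.2.1) (y.1.1.1, y.1.2.1) x.2 y.2

/-- The row and column of the inserted matrix have types depending on the split indices. Passing to
`tensorEntry` replaces both split indices at once, together with everything that depends on them. -/
theorem mat_tensorHom_eq {m₁ s₁ m₂ s₂ : Hat E} (X : m₁ ⟶ s₁) (Y : m₂ ⟶ s₂) (P Q) {x y}
    (hx : splitIdx c s₁.mult s₂.mult P = x) (hy : splitIdx c m₁.mult m₂.mult Q = y) :
    Hat.mat (φ.tensorHom X Y) P Q = φ.tensorEntry X Y x y := by
  subst hx hy
  rfl

/-- For `1 × 1` matrices nothing is concatenated: there is one inserted block, and its rows keep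
their order by `splitIdx_single`. -/
theorem tensorHom_single {i i' j j' : Fin (n + 1)} (X : Hat.single E i ⟶ Hat.single E i')
    (Y : Hat.single E j ⟶ Hat.single E j') :
    φ.tensorHom X Y = eqToHom (Hat.tensor_single i j) ≫
      φ.comp (Hat.mat X ⟨i', ⟨0, by simp⟩⟩ ⟨i, ⟨0, by simp⟩⟩)
        (Hat.mat Y ⟨j', ⟨0, by simp⟩⟩ ⟨j, ⟨0, by simp⟩⟩) i j i' j' ≫
      eqToHom (Hat.tensor_single i' j').symm := by
  refine Hat.hom_ext fun P Q => ?_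
  rw [Hat.mat_eqToHom_comp, Hat.mat_comp_eqToHom]
  exact φ.mat_tensorHom_eq X Y P Q (splitIdx_single i' j' P) (splitIdx_single i j Q)

theorem block_idem_apply (i j k : Fin (n + 1)) (hc : c i j = unitVec k) (P Q : Idx (c i j)) :
    (φ.toAlgHom (E.e i ⊗ₜ E.e j)).block (i, j) (i, j) P Q = E.e k := by
  have key : ∀ P : Idx (c i j), P = castIdx hc.symm ⟨k, ⟨0, by simp⟩⟩ := fun P =>
    congrArg (castIdx hc.symm) (unitVec_idx (castIdx hc P))
  rw [key P, key Q, φ.map_idem, MAlg.block_unit_self]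
  exact Matrix.diagonal_apply_eq _ _

/-- Naturality of the left unit constraint of `Ĉ` for insertions. By `splitIdx_unit_left` the row
`P` stays in place, so an entry is nonzero only at `P = q`. There it is the single entry of the
identity matrix of type `c 0 q.1`, a unit vector. -/
theorem id_tensorHom_ins (hc : ∀ i, c 0 i = unitVec i) (m : Hat E)
    (h : Hat.tensor c (Hat.single E 0) m = m) (q : Idx m.mult)
    (h' : Hat.tensor c (Hat.single E 0) (Hat.single E q.1) = Hat.single E q.1) :
    φ.tensorHom (𝟙 (Hat.single E 0)) (Hat.ins m q) ≫ eqToHom h = eqToHom h' ≫ Hat.ins m q := by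
  refine Hat.hom_ext fun P Q => ?_
  have hx := splitIdx_unit_left hc (congrArg Hat.mult h) P
  rw [Hat.mat_eqToHom_comp, Hat.mat_comp_eqToHom, Hat.mat_ins]
  have h1 := φ.mat_tensorHom_eq (𝟙 (Hat.single E 0)) (Hat.ins m q) (castIdx (congrArg Hat.mult h.symm) P) Q hx (splitIdx_single 0 q.1 Q)
  refine h1.trans ?_
  rw [tensorEntry]
  dsimp only
  rw [Hat.mat_id, Matrix.diagonal_apply_eq, Hat.mat_ins]
  by_cases hP : P = q
  · subst hP
    rw [if_pos rfl]
    exact φ.block_idem_apply 0 P.1 P.1 (hc _) _ _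
  · rw [if_neg hP, TensorProduct.tmul_zero, map_zero]
    rfl

theorem ins_tensorHom_id (hc : ∀ i, c i 0 = unitVec i) (m : Hat E)
    (h : Hat.tensor c m (Hat.single E 0) = m) (p : Idx m.mult)
    (h' : Hat.tensor c (Hat.single E p.1) (Hat.single E 0) = Hat.single E p.1) :
    φ.tensorHom (Hat.ins m p) (𝟙 (Hat.single E 0)) ≫ eqToHom h = eqToHom h' ≫ Hat.ins m p := by
  refine Hat.hom_ext fun P Q => ?_
  have hx := splitIdx_unit_right hc (congrArg Hat.mult h) P
  rw [Hat.mat_eqToHom_comp, Hat.mat_comp_eqToHom, Hat.mat_ins]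
  have h1 := φ.mat_tensorHom_eq (Hat.ins m p) (𝟙 (Hat.single E 0)) (castIdx (congrArg Hat.mult h.symm) P) Q hx (splitIdx_single p.1 0 Q)
  refine h1.trans ?_
  rw [tensorEntry]
  dsimp only
  rw [Hat.mat_id, Matrix.diagonal_apply_eq, Hat.mat_ins]
  by_cases hP : P = p
  · subst hP
    rw [if_pos rfl]
    exact φ.block_idem_apply P.1 0 P.1 (hc _) _ _
  · rw [if_neg hP, TensorProduct.zero_tmul, map_zero]
    rfl

end TensorMap

end Hat

/-! ### Morphisms tested on direct summands -/

section SumDec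

variable {D : Type*} [Category D] [Preadditive D] {W : Type} [Fintype W] {P Q : D} {U U' : W → D}

theorem SumDec.hom_ext_inc (d : SumDec P U) {f g : P ⟶ Q} (h : ∀ w, d.inc w ≫ f = d.inc w ≫ g) :
    f = g := by
  rw [← Category.id_comp f, ← Category.id_comp g, ← d.total, Preadditive.sum_comp,
    Preadditive.sum_comp]
  exact Finset.sum_congr rfl fun w _ => by rw [Category.assoc, h, Category.assoc]

theorem SumDec.hom_ext_prj (d : SumDec Q U) {f g : P ⟶ Q} (h : ∀ w, f ≫ d.prj w = g ≫ d.prj w) :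
    f = g := by
  rw [← Category.comp_id f, ← Category.comp_id g, ← d.total, Preadditive.comp_sum,
    Preadditive.comp_sum]
  exact Finset.sum_congr rfl fun w _ => by rw [← Category.assoc, h, Category.assoc]

theorem SumDec.inc_mapIso (d : SumDec P U) (d' : SumDec Q U') (g : ∀ w, U w ≅ U' w) (w : W) :
    d.inc w ≫ (d.mapIso d' g).hom = (g w).hom ≫ d'.inc w := by
  change d.inc w ≫ (∑ w, d.prj w ≫ (g w).hom ≫ d'.inc w) = _
  rw [Preadditive.comp_sum, Finset.sum_eq_single w]
  · rw [← Category.assoc, d.inc_prj, Category.id_comp]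
  · intro w' _ h
    rw [← Category.assoc, d.inc_prj_ne w w' (Ne.symm h), zero_comp]
  · simp

theorem SumDec.mapIso_prj (d : SumDec P U) (d' : SumDec Q U') (g : ∀ w, U w ≅ U' w) (w : W) :
    (d.mapIso d' g).hom ≫ d'.prj w = d.prj w ≫ (g w).hom := by
  refine d.hom_ext_inc fun w' => ?_
  rw [← Category.assoc, d.inc_mapIso, Category.assoc]
  by_cases h : w' = w
  · subst h
    rw [d'.inc_prj, Category.comp_id, ← Category.assoc, d.inc_prj, Category.id_comp]
  · rw [d'.inc_prj_ne _ _ h, ← Category.assoc, d.inc_prj_ne _ _ h, comp_zero, zero_comp]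

end SumDec

/-! ### The linear equivalence given by `V^{(m)}` and the naturality of `θ` -/

section Data

variable {𝕜 : Type*} [Field 𝕜] {C : Type u} [Category.{v} C] [Preadditive C] [Linear 𝕜 C]
  [HasFiniteBiproducts C] [HasBinaryBiproducts C]

section Linear

variable {n : ℕ} {V : Fin (n + 1) → C}

/-- The inclusion of the summand `p` of `V^{(m)}`. -/
def powInc (m : Hat (idemFamily 𝕜 V)) (p : Idx m.mult) : V p.1 ⟶ powObj V m.mult :=
  biproduct.ι (fun p : Idx m.mult => V p.1) p

/-- The projection to the summand `p` of `V^{(m)}`. -/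
def powPrj (m : Hat (idemFamily 𝕜 V)) (p : Idx m.mult) : powObj V m.mult ⟶ V p.1 :=
  biproduct.π (fun p : Idx m.mult => V p.1) p

theorem powInc_ofMat_powPrj {m s : Hat (idemFamily 𝕜 V)} (X : m ⟶ s) (q : Idx m.mult)
    (p : Idx s.mult) : powInc m q ≫ ofMat X ≫ powPrj s p =
      biproduct.ι V q.1 ≫ entry X p q ≫ biproduct.π V p.1 := by
  rw [ofMat, powInc, powPrj]
  simp

theorem ofMat_smul {m s : Hat (idemFamily 𝕜 V)} (a : 𝕜) (X : m ⟶ s) :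
    ofMat (a • X) = a • ofMat X := by
  conv_lhs => rw [← toMat_ofMat X, ← toMat_smul, ofMat_toMat]

theorem ofMat_eqToHom {m s : Hat (idemFamily 𝕜 V)} (h : m = s) :
    ofMat (eqToHom h) = eqToHom (congrArg (fun m : Hat (idemFamily 𝕜 V) => powObj V m.mult) h) := by
  subst h
  exact ofMat_id m

/-- The object `V^{(e_i)}` is `V_i`. -/
def powSingle (V : Fin (n + 1) → C) (i : Fin (n + 1)) : V i ≅ powObj V (unitVec i) where
  hom := biproduct.ι (fun p : Idx (unitVec i) => V p.1) ⟨i, ⟨0, by simp⟩⟩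
  inv := biproduct.π (fun p : Idx (unitVec i) => V p.1) ⟨i, ⟨0, by simp⟩⟩
  hom_inv_id := biproduct.ι_π_self _ _
  inv_hom_id := by
    rw [← biproduct.total]
    exact (sum_unitVec i fun w => biproduct.π (fun p : Idx (unitVec i) => V p.1) w ≫
      biproduct.ι (fun p : Idx (unitVec i) => V p.1) w).symm

/-- Under the identification of `V_i` with `V^{(e_i)}`, the column `X_p` is the inclusion of the
summand `p`. This allows formulas in `Ĉ` written with insertions to be tested on the summands of
`V^{(m)}`. -/
theorem powSingle_ofMat_ins (m : Hat (idemFamily 𝕜 V)) (p : Idx m.mult) :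
    (powSingle V p.1).hom ≫ ofMat (Hat.ins m p) = powInc m p := by
  refine biproduct.hom_ext _ _ fun p' => ?_
  rw [Category.assoc]
  refine (powInc_ofMat_powPrj (Hat.ins m p) _ _).trans ?_
  by_cases h : p' = p
  · subst h
    have h1 : entry (Hat.ins m p') p' ⟨p'.1, ⟨0, by simp⟩⟩ =
        biproduct.π V p'.1 ≫ biproduct.ι V p'.1 := if_pos rfl
    rw [h1, powInc, biproduct.ι_π_self]
    simp
  · have h1 : entry (Hat.ins m p) p' ⟨p.1, ⟨0, by simp⟩⟩ = 0 := if_neg h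
    rw [h1, powInc, biproduct.ι_π_ne _ (Ne.symm h)]
    simp

variable (𝕜 V) in
/-- The functor `m ↦ V^{(m)}`. -/
def ofMatFunctor : Hat (idemFamily 𝕜 V) ⥤ C where
  obj m := powObj V m.mult
  map := ofMat
  map_id := ofMat_id
  map_comp := ofMat_comp

variable (𝕜 V) in
/-- The functor `m ↦ V^{(m)}` is fully faithful. -/
def ofMatFullyFaithful : (ofMatFunctor 𝕜 V).FullyFaithful where
  preimage := toMat
  map_preimage := ofMat_toMat
  preimage_map := toMat_ofMat

instance : (ofMatFunctor 𝕜 V).Full := (ofMatFullyFaithful 𝕜 V).full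

instance : (ofMatFunctor 𝕜 V).Faithful := (ofMatFullyFaithful 𝕜 V).faithful

instance : (ofMatFunctor 𝕜 V).Additive where
  map_add := ofMat_add _ _

instance : (ofMatFunctor 𝕜 V).Linear 𝕜 where
  map_smul _ _ := ofMat_smul _ _

end Linear

section Tensor

variable [MonoidalCategory C] [MonoidalPreadditive C] [MonoidalLinear 𝕜 C] [IsKrullSchmidt C]
  {n : ℕ} {S : IndecReps C n}

/-- Each summand of a decomposition of `X` is isomorphic to exactly one `V_j`. Grouping the summands
by this `j` turns the decomposition into one indexed by the rows of type `mult S X`. -/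
theorem nonempty_iso_powObj (S : IndecReps C n) (X : C) :
    Nonempty (X ≅ powObj S.V (mult S X)) := by
  obtain ⟨r, f, hf, ⟨d⟩⟩ := exists_sumDec X
  choose i g using fun k => S.exists_iso (f k) (hf k)
  have h (k : Fin r) (j : Fin (n + 1)) : Nonempty (f k ≅ S.V j) ↔ i k = j :=
    ⟨fun ⟨g'⟩ => S.eq_of_iso _ _ ⟨(g k).some.symm.trans g'⟩, fun h => h ▸ g k⟩
  have hm (j : Fin (n + 1)) : Nat.card {k : Fin r // i k = j} = mult S X j := by
    rw [mult_eq S d hf]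
    simp only [h]
  -- The summands isomorphic to `V_j` form the fibre of `i` over `j`. It has `mult S X j` elements,
  -- and numbering each fibre gives the bijection.
  let e : Idx (mult S X) ≃ Fin r :=
    (Equiv.sigmaCongrRight fun j => (Finite.equivFinOfCardEq (hm j)).symm).trans
      (Equiv.sigmaFiberEquiv i)
  have he (w : Idx (mult S X)) : i (e w) = w.1 := ((Finite.equivFinOfCardEq (hm w.1)).symm w.2).2
  exact ⟨(d.reindex e).mapIso (biproductDec _) fun w =>
    (g (e w)).some.trans (eqToIso (congrArg S.V (he w)))⟩

instance : (ofMatFunctor 𝕜 S.V).EssSurj where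
  mem_essImage X := by
    obtain ⟨e⟩ := nonempty_iso_powObj S X
    exact ⟨⟨mult S X⟩, ⟨e.symm⟩⟩

namespace FusionIsos

variable (θ : FusionIsos S)

variable (𝕜) in
/-- The isomorphism `V_i ⊗ V_j ≅ V^{(e_i ⊗̂ e_j)}`. -/
def isoTens (i j : Fin (n + 1)) : S.V i ⊗ S.V j ≅ powObj S.V
    (Hat.tensor (greenBasis S).c (Hat.single (idemFamily 𝕜 S.V) i) (Hat.single _ j)).mult :=
  (θ.iso i j).trans
    (eqToIso (congrArg (fun m : Hat (idemFamily 𝕜 S.V) => powObj S.V m.mult)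
    (Hat.tensor_single (c := (greenBasis S).c) i j).symm))

theorem isoTens_hom (i j : Fin (n + 1)) : (θ.isoTens 𝕜 i j).hom = (θ.iso i j).hom ≫
    eqToHom (congrArg (fun m : Hat (idemFamily 𝕜 S.V) => powObj S.V m.mult)
    (Hat.tensor_single (c := (greenBasis S).c) i j).symm) := rfl

/-- The defining property of `θ(m, s)` on a pair of summands, where it is `θ_{ij}` followed by the
insertion `X_p ⊗̂ X_q`. -/
theorem powInc_total (m s : Hat (idemFamily 𝕜 S.V)) (p : Idx m.mult) (q : Idx s.mult) :
    (powInc m p ⊗ₘ powInc s q) ≫ (θ.total 𝕜 m s).hom =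
      (θ.isoTens 𝕜 p.1 q.1).hom ≫ ofMat ((θ.φ 𝕜).tensorHom (Hat.ins m p) (Hat.ins s q)) :=
  SumDec.inc_mapIso ((biproductDec fun p : Idx m.mult => S.V p.1).tensor
    (biproductDec fun q : Idx s.mult => S.V q.1)) (ofMatDec ((θ.φ 𝕜).sumDec m.dec s.dec)) _ (p, q)

theorem total_powPrj (m s : Hat (idemFamily 𝕜 S.V)) (p : Idx m.mult) (q : Idx s.mult) :
    (θ.total 𝕜 m s).hom ≫ ofMat ((θ.φ 𝕜).tensorHom (Hat.prj m p) (Hat.prj s q)) =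
      (powPrj m p ⊗ₘ powPrj s q) ≫ (θ.isoTens 𝕜 p.1 q.1).hom :=
  SumDec.mapIso_prj ((biproductDec fun p : Idx m.mult => S.V p.1).tensor
    (biproductDec fun q : Idx s.mult => S.V q.1)) (ofMatDec ((θ.φ 𝕜).sumDec m.dec s.dec)) _ (p, q)

/-- The blocks of `φ (x ⊗ y)` are matrices of `x ⊗ y` conjugated by the `θ_{ij}`. Composing with
`θ_{ij}` undoes the conjugation and leaves the components of `x` and `y`. -/
theorem ofMat_comp_φ (x y : ⨁ S.V ⟶ ⨁ S.V) (i j i' j' : Fin (n + 1)) :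
    (θ.iso i j).hom ≫ ofMat ((θ.φ 𝕜).comp x y i j i' j') =
      ((biproduct.ι S.V i ≫ x ≫ biproduct.π S.V i') ⊗ₘ
        (biproduct.ι S.V j ≫ y ≫ biproduct.π S.V j')) ≫ (θ.iso i' j').hom := by
  have h : (θ.φ 𝕜).comp x y i j i' j' = toMat (((θ.iso i j).inv ≫
      (biproduct.ι S.V i ⊗ₘ biproduct.ι S.V j)) ≫ (x ⊗ₘ y) ≫
        ((biproduct.π S.V i' ⊗ₘ biproduct.π S.V j') ≫ (θ.iso i' j').hom)) := by
    rw [← tensorEnd_tmul 𝕜]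
    rfl
  rw [h]
  refine (congrArg _ (ofMat_toMat _)).trans ?_
  simp

theorem isoTens_ofMat_tensorHom {i i' j j' : Fin (n + 1)}
    (X : Hat.single (idemFamily 𝕜 S.V) i ⟶ Hat.single _ i')
    (Y : Hat.single (idemFamily 𝕜 S.V) j ⟶ Hat.single _ j') :
    (θ.isoTens 𝕜 i j).hom ≫ ofMat ((θ.φ 𝕜).tensorHom X Y) =
      ((biproduct.ι S.V i ≫ entry X ⟨i', ⟨0, by simp⟩⟩ ⟨i, ⟨0, by simp⟩⟩ ≫ biproduct.π S.V i') ⊗ₘ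
        (biproduct.ι S.V j ≫ entry Y ⟨j', ⟨0, by simp⟩⟩ ⟨j, ⟨0, by simp⟩⟩ ≫
          biproduct.π S.V j')) ≫ (θ.isoTens 𝕜 i' j').hom := by
  rw [isoTens_hom, isoTens_hom, entry, entry, TensorMap.tensorHom_single,
    ofMat_comp, ofMat_comp, ofMat_eqToHom, ofMat_eqToHom, Category.assoc, eqToHom_trans_assoc,
    eqToHom_refl, Category.id_comp, ← Category.assoc, θ.ofMat_comp_φ, Category.assoc]

/-- It suffices to restrict to a pair of summands of the source and project to a pair of summands of
the target. The interchange law in `C` and in `Ĉ` then replaces `X` and `Y` by single entries, and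
the claim becomes `isoTens_ofMat_tensorHom`. -/
theorem total_natural {m s m' s' : Hat (idemFamily 𝕜 S.V)} (X : m ⟶ m') (Y : s ⟶ s') :
    (ofMat X ⊗ₘ ofMat Y) ≫ (θ.total 𝕜 m' s').hom =
      (θ.total 𝕜 m s).hom ≫ ofMat ((θ.φ 𝕜).tensorHom X Y) := by
  refine ((biproductDec fun p : Idx m.mult => S.V p.1).tensor
    (biproductDec fun q : Idx s.mult => S.V q.1)).hom_ext_inc fun ⟨p, q⟩ => ?_
  refine (ofMatDec ((θ.φ 𝕜).sumDec m'.dec s'.dec)).hom_ext_prj fun ⟨p', q'⟩ => ?_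
  change ((powInc m p ⊗ₘ powInc s q) ≫ _ ≫ _) ≫
      ofMat ((θ.φ 𝕜).tensorHom (Hat.prj m' p') (Hat.prj s' q')) =
    ((powInc m p ⊗ₘ powInc s q) ≫ _ ≫ _) ≫
      ofMat ((θ.φ 𝕜).tensorHom (Hat.prj m' p') (Hat.prj s' q'))
  rw [Category.assoc, Category.assoc, θ.total_powPrj, tensorHom_comp_tensorHom_assoc,
    tensorHom_comp_tensorHom_assoc, Category.assoc, Category.assoc, powInc_ofMat_powPrj,
    powInc_ofMat_powPrj, Category.assoc, Category.assoc, reassoc_of% (θ.powInc_total m s p q),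
    ← ofMat_comp, ← ofMat_comp, ← TensorMap.tensorHom_comp, ← TensorMap.tensorHom_comp,
    θ.isoTens_ofMat_tensorHom]
  simp only [entry, Hat.mat_ins_comp_prj]

end FusionIsos

end Tensor

end Data

theorem Hat.ins_single {𝕜 A : Type*} [Field 𝕜] [Ring A] [Algebra 𝕜 A] {n : ℕ}
    {E : IdemFamily 𝕜 A n} (i : Fin (n + 1)) :
    Hat.ins (Hat.single E i) ⟨i, ⟨0, by simp⟩⟩ = 𝟙 (Hat.single E i) := by
  refine Hat.hom_ext fun p q => ?_
  rw [Hat.mat_ins, Hat.mat_id, unitVec_idx p, unitVec_idx q, if_pos rfl, Matrix.diagonal_apply_eq]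

/-! ### Transport of the unit and associativity constraints -/

section Data

variable {𝕜 : Type*} [Field 𝕜] {C : Type u} [Category.{v} C] [Preadditive C] [Linear 𝕜 C]
  [HasFiniteBiproducts C] [HasBinaryBiproducts C]

/-- The normalization of `θ` lands in `V^{(c_{0i})}` or `V^{(c_{i0})}`, whose type equals `e_i` only
propositionally. This compares its inclusion with the identification of `V_i` with `V^{(e_i)}`. -/
theorem ι_eqToHom_powSingle {n : ℕ} (V : Fin (n + 1) → C) {m : Fin (n + 1) → ℕ} {i : Fin (n + 1)}
    (h : m = unitVec i) (h' : 0 < m i) :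
    biproduct.ι (fun p : Idx m => V p.1) ⟨i, ⟨0, h'⟩⟩ ≫ eqToHom (congrArg (powObj V) h) =
      (powSingle V i).hom := by
  subst h
  rw [eqToHom_refl, Category.comp_id]
  rfl

variable [MonoidalCategory C] [MonoidalPreadditive C] [MonoidalLinear 𝕜 C] [IsKrullSchmidt C]
  {n : ℕ} {S : IndecReps C n}

namespace FusionIsos

variable (θ : FusionIsos S)

variable (S) in
/-- The unit object of `C` is `V^{(e_0)}`. -/
def unitIso : 𝟙_ C ≅ powObj S.V (unitVec 0) := eqToIso S.V_zero.symm ≪≫ powSingle S.V 0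

theorem powSingle_unitIso_inv : (powSingle S.V 0).hom ≫ (unitIso S).inv = eqToHom S.V_zero := by
  simp [unitIso]

/-- On the summand `q` of `V^{(m)}` the isomorphism is `θ_{0j}`, with `j` the block of `q`; by
normalization this is the left unit constraint of `V_j`. The passage from the summand to `V^{(m)}`
is naturality of both unit constraints: `id_tensorHom_ins` in `Ĉ`, and that of `λ` in `C`. -/
theorem total_leftUnitor (m : Hat (idemFamily 𝕜 S.V))
    (h : Hat.tensor (greenBasis S).c (Hat.single _ 0) m = m) :
    (θ.total 𝕜 (Hat.single _ 0) m).hom ≫ ofMat (eqToHom h) =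
      (unitIso S).inv ▷ powObj S.V m.mult ≫ (λ_ _).hom := by
  refine ((biproductDec fun p : Idx (unitVec 0) => S.V p.1).tensor
    (biproductDec fun q : Idx m.mult => S.V q.1)).hom_ext_inc fun ⟨p, q⟩ => ?_
  obtain rfl := unitVec_idx p
  have h' : Hat.tensor (greenBasis S).c (Hat.single (idemFamily 𝕜 S.V) 0) (Hat.single _ q.1) =
      Hat.single _ q.1 := Hat.ext ((greenBasis S).tens_zero_left _)
  -- The only place where `zero_left` enters.
  have h1 : (θ.isoTens 𝕜 0 q.1).hom ≫ ofMat (eqToHom h') =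
      eqToHom S.V_zero ▷ S.V q.1 ≫ (λ_ (S.V q.1)).hom ≫ (powSingle S.V q.1).hom := by
    rw [isoTens_hom, ofMat_eqToHom, Category.assoc, eqToHom_trans, θ.zero_left, Category.assoc,
      Category.assoc]
    exact congrArg (fun f => _ ≫ _ ≫ f)
      (ι_eqToHom_powSingle S.V ((greenBasis S).c_zero_left q.1) _)
  change (powInc (Hat.single (idemFamily 𝕜 S.V) 0) ⟨0, ⟨0, by simp⟩⟩ ⊗ₘ powInc m q) ≫ _ =
    ((powSingle S.V 0).hom ⊗ₘ powInc m q) ≫ _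
  rw [reassoc_of% (θ.powInc_total (Hat.single (idemFamily 𝕜 S.V) 0) m ⟨0, ⟨0, by simp⟩⟩ q),
    ← ofMat_comp, Hat.ins_single, TensorMap.id_tensorHom_ins _ (greenBasis S).c_zero_left m h q h',
    ofMat_comp, reassoc_of% h1, powSingle_ofMat_ins, MonoidalCategory.tensorHom_def, Category.assoc,
    ← leftUnitor_naturality, whisker_exchange_assoc, ← comp_whiskerRight_assoc,
    powSingle_unitIso_inv]

theorem total_rightUnitor (m : Hat (idemFamily 𝕜 S.V))
    (h : Hat.tensor (greenBasis S).c m (Hat.single _ 0) = m) :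
    (θ.total 𝕜 m (Hat.single _ 0)).hom ≫ ofMat (eqToHom h) =
      powObj S.V m.mult ◁ (unitIso S).inv ≫ (ρ_ _).hom := by
  refine ((biproductDec fun q : Idx m.mult => S.V q.1).tensor
    (biproductDec fun p : Idx (unitVec 0) => S.V p.1)).hom_ext_inc fun ⟨q, p⟩ => ?_
  obtain rfl := unitVec_idx p
  have h' : Hat.tensor (greenBasis S).c (Hat.single (idemFamily 𝕜 S.V) q.1) (Hat.single _ 0) =
      Hat.single _ q.1 := Hat.ext ((greenBasis S).tens_zero_right _)
  have h1 : (θ.isoTens 𝕜 q.1 0).hom ≫ ofMat (eqToHom h') =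
      S.V q.1 ◁ eqToHom S.V_zero ≫ (ρ_ (S.V q.1)).hom ≫ (powSingle S.V q.1).hom := by
    rw [isoTens_hom, ofMat_eqToHom, Category.assoc, eqToHom_trans, θ.zero_right, Category.assoc,
      Category.assoc]
    exact congrArg (fun f => _ ≫ _ ≫ f)
      (ι_eqToHom_powSingle S.V ((greenBasis S).c_zero_right q.1) _)
  change (powInc m q ⊗ₘ powInc (Hat.single (idemFamily 𝕜 S.V) 0) ⟨0, ⟨0, by simp⟩⟩) ≫ _ =
    (powInc m q ⊗ₘ (powSingle S.V 0).hom) ≫ _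
  rw [reassoc_of% (θ.powInc_total m (Hat.single (idemFamily 𝕜 S.V) 0) q ⟨0, ⟨0, by simp⟩⟩),
    ← ofMat_comp, Hat.ins_single, TensorMap.ins_tensorHom_id _ (greenBasis S).c_zero_right m h q h',
    ofMat_comp, reassoc_of% h1, powSingle_ofMat_ins, tensorHom_def', Category.assoc,
    ← rightUnitor_naturality, ← whisker_exchange_assoc, ← whiskerLeft_comp_assoc,
    powSingle_unitIso_inv]

theorem ofMat_tensorHom_total_inv {m s m' s' : Hat (idemFamily 𝕜 S.V)} (X : m ⟶ m') (Y : s ⟶ s') :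
    ofMat ((θ.φ 𝕜).tensorHom X Y) ≫ (θ.total 𝕜 m' s').inv =
      (θ.total 𝕜 m s).inv ≫ (ofMat X ⊗ₘ ofMat Y) := by
  rw [Iso.comp_inv_eq, Category.assoc, θ.total_natural, Iso.inv_hom_id_assoc]

variable (𝕜) in
/-- The associativity constraint of `C` as an isomorphism
`V^{((m ⊗̂ s) ⊗̂ t)} ≅ V^{(m ⊗̂ (s ⊗̂ t))}`. -/
def assocPow (m s t : Hat (idemFamily 𝕜 S.V)) :
    powObj S.V (Hat.tensor (greenBasis S).c (Hat.tensor (greenBasis S).c m s) t).mult ≅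
      powObj S.V (Hat.tensor (greenBasis S).c m (Hat.tensor (greenBasis S).c s t)).mult :=
  (θ.total 𝕜 (Hat.tensor _ m s) t).symm ≪≫ whiskerRightIso (θ.total 𝕜 m s).symm _ ≪≫
    α_ _ _ _ ≪≫ whiskerLeftIso _ (θ.total 𝕜 s t) ≪≫ θ.total 𝕜 m (Hat.tensor _ s t)

theorem assocPow_hom (m s t : Hat (idemFamily 𝕜 S.V)) :
    (θ.assocPow 𝕜 m s t).hom = (θ.total 𝕜 (Hat.tensor _ m s) t).inv ≫
      (θ.total 𝕜 m s).inv ▷ _ ≫ (α_ _ _ _).hom ≫ _ ◁ (θ.total 𝕜 s t).hom ≫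
        (θ.total 𝕜 m (Hat.tensor _ s t)).hom := rfl

/-- Every factor of the transported associator is natural: the `θ` by `total_natural`, and `α` by
the axioms of `C`. -/
theorem assocPow_natural {m s t m' s' t' : Hat (idemFamily 𝕜 S.V)} (X : m ⟶ m') (Y : s ⟶ s')
    (Z : t ⟶ t') :
    ofMat ((θ.φ 𝕜).tensorHom ((θ.φ 𝕜).tensorHom X Y) Z) ≫ (θ.assocPow 𝕜 m' s' t').hom =
      (θ.assocPow 𝕜 m s t).hom ≫ ofMat ((θ.φ 𝕜).tensorHom X ((θ.φ 𝕜).tensorHom Y Z)) := by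
  have h1 : (ofMat ((θ.φ 𝕜).tensorHom X Y) ⊗ₘ ofMat Z) ≫ (θ.total 𝕜 m' s').inv ▷ _ =
      (θ.total 𝕜 m s).inv ▷ _ ≫ ((ofMat X ⊗ₘ ofMat Y) ⊗ₘ ofMat Z) := by
    rw [← tensorHom_id, ← tensorHom_id, tensorHom_comp_tensorHom, tensorHom_comp_tensorHom,
      θ.ofMat_tensorHom_total_inv, Category.comp_id, Category.id_comp]
  have h2 : (ofMat X ⊗ₘ (ofMat Y ⊗ₘ ofMat Z)) ≫ _ ◁ (θ.total 𝕜 s' t').hom =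
      _ ◁ (θ.total 𝕜 s t).hom ≫ (ofMat X ⊗ₘ ofMat ((θ.φ 𝕜).tensorHom Y Z)) := by
    rw [← id_tensorHom, ← id_tensorHom, tensorHom_comp_tensorHom, tensorHom_comp_tensorHom,
      θ.total_natural, Category.comp_id, Category.id_comp]
  rw [assocPow_hom, assocPow_hom, ← Category.assoc, θ.ofMat_tensorHom_total_inv]
  simp only [Category.assoc]
  rw [reassoc_of% h1, associator_naturality_assoc, reassoc_of% h2, θ.total_natural]

theorem ofMat_assoc (i j l : Fin (n + 1)) :
    ofMat (θ.assoc 𝕜 i j l).hom =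
      (θ.assocPow 𝕜 (Hat.single _ i) (Hat.single _ j) (Hat.single _ l)).hom :=
  ofMat_toMat _

/-- A natural transformation between additive constructions is determined by its values on summands.
By naturality, `assocPow` at `m, s, t` followed by the projection to a triple of summands is the
triple projection followed by `assocPow` at unit vectors. The latter is `a_{ijl}`, so summing over
all triples yields the formula for the constraint of `Ĉ`. -/
theorem ofMat_quadruple_assoc (m s t : Hat (idemFamily 𝕜 S.V)) :
    ofMat ((θ.quadruple 𝕜).assoc m s t).hom = (θ.assocPow 𝕜 m s t).hom := by
  have h : ofMat ((θ.quadruple 𝕜).assoc m s t).hom =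
      ofMat (m := Hat.tensor (greenBasis S).c (Hat.tensor (greenBasis S).c m s) t)
        (s := Hat.tensor (greenBasis S).c m (Hat.tensor (greenBasis S).c s t))
        (∑ p : Idx m.mult, ∑ q : Idx s.mult, ∑ r : Idx t.mult,
          (θ.φ 𝕜).tensorHom ((θ.φ 𝕜).tensorHom (Hat.prj m p) (Hat.prj s q)) (Hat.prj t r) ≫
            (θ.assoc 𝕜 p.1 q.1 r.1).hom ≫
              (θ.φ 𝕜).tensorHom (Hat.ins m p) ((θ.φ 𝕜).tensorHom (Hat.ins s q) (Hat.ins t r))) :=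
    rfl
  -- The identity of `m ⊗̂ (s ⊗̂ t)` resolved over triples of rows; it is inserted behind
  -- `assocPow`.
  have ht : ∑ p : Idx m.mult, ∑ q : Idx s.mult, ∑ r : Idx t.mult,
      (θ.φ 𝕜).tensorHom (Hat.prj m p) ((θ.φ 𝕜).tensorHom (Hat.prj s q) (Hat.prj t r)) ≫
        (θ.φ 𝕜).tensorHom (Hat.ins m p) ((θ.φ 𝕜).tensorHom (Hat.ins s q) (Hat.ins t r)) =
      𝟙 _ := by
    have h := ((θ.φ 𝕜).sumDec m.dec ((θ.φ 𝕜).sumDec s.dec t.dec)).total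
    rw [Fintype.sum_prod_type] at h
    refine (Finset.sum_congr rfl fun p _ => ?_).trans h
    rw [Fintype.sum_prod_type]
    rfl
  have ht' := congrArg ofMat ht
  rw [ofMat_id] at ht'
  rw [h, ← Category.comp_id (θ.assocPow 𝕜 m s t).hom, ← ht']
  simp only [ofMat_sum, Preadditive.comp_sum]
  refine Finset.sum_congr rfl fun p _ => Finset.sum_congr rfl fun q _ =>
    Finset.sum_congr rfl fun r _ => ?_
  rw [ofMat_comp, ofMat_comp, ofMat_comp, θ.ofMat_assoc, reassoc_of% (θ.assocPow_natural
    (Hat.prj m p) (Hat.prj s q) (Hat.prj t r))]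

theorem ofMat_tensorHom {m s m' s' : Hat (idemFamily 𝕜 S.V)} (X : m ⟶ m') (Y : s ⟶ s') :
    ofMat ((θ.φ 𝕜).tensorHom X Y) =
      (θ.total 𝕜 m s).inv ≫ (ofMat X ⊗ₘ ofMat Y) ≫ (θ.total 𝕜 m' s').hom := by
  rw [Iso.eq_inv_comp, θ.total_natural]

theorem ofMat_whiskerLeft (m : Hat (idemFamily 𝕜 S.V)) {s s' : Hat (idemFamily 𝕜 S.V)}
    (Y : s ⟶ s') : ofMat ((θ.φ 𝕜).tensorHom (𝟙 m) Y) =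
      (θ.total 𝕜 m s).inv ≫ (powObj S.V m.mult ◁ ofMat Y) ≫ (θ.total 𝕜 m s').hom := by
  rw [θ.ofMat_tensorHom, ofMat_id, id_tensorHom]

theorem ofMat_whiskerRight {m m' : Hat (idemFamily 𝕜 S.V)} (X : m ⟶ m')
    (s : Hat (idemFamily 𝕜 S.V)) : ofMat ((θ.φ 𝕜).tensorHom X (𝟙 s)) =
      (θ.total 𝕜 m s).inv ≫ (ofMat X ▷ powObj S.V s.mult) ≫ (θ.total 𝕜 m' s).hom := by
  rw [θ.ofMat_tensorHom, ofMat_id, tensorHom_id]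

theorem ofMat_associator (m s t : Hat (idemFamily 𝕜 S.V)) :
    ofMat ((θ.quadruple 𝕜).assoc m s t).hom =
      (((θ.total 𝕜 _ _).symm ≪≫ ((θ.total 𝕜 _ _).symm ⊗ᵢ Iso.refl _)) ≪≫
        α_ (powObj S.V m.mult) (powObj S.V s.mult) (powObj S.V t.mult) ≪≫
        ((Iso.refl _ ⊗ᵢ θ.total 𝕜 _ _) ≪≫ θ.total 𝕜 _ _)).hom := by
  rw [θ.ofMat_quadruple_assoc, assocPow_hom]
  simp
  rfl

theorem ofMat_leftUnitor (m : Hat (idemFamily 𝕜 S.V))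
    (h : Hat.tensor (greenBasis S).c (Hat.single _ 0) m = m) :
    ofMat (eqToIso h).hom =
      (((θ.total 𝕜 _ _).symm ≪≫ ((unitIso S).symm ⊗ᵢ Iso.refl _)) ≪≫
        λ_ (powObj S.V m.mult)).hom := by
  rw [eqToIso.hom, Iso.trans_hom, Iso.trans_hom, Category.assoc, Iso.symm_hom, Iso.eq_inv_comp,
    θ.total_leftUnitor, tensorIso_hom, Iso.refl_hom, tensorHom_id, Iso.symm_hom]

theorem ofMat_rightUnitor (m : Hat (idemFamily 𝕜 S.V))
    (h : Hat.tensor (greenBasis S).c m (Hat.single _ 0) = m) :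
    ofMat (eqToIso h).hom =
      (((θ.total 𝕜 _ _).symm ≪≫ (Iso.refl _ ⊗ᵢ (unitIso S).symm)) ≪≫
        ρ_ (powObj S.V m.mult)).hom := by
  rw [eqToIso.hom, Iso.trans_hom, Iso.trans_hom, Category.assoc, Iso.symm_hom, Iso.eq_inv_comp,
    θ.total_rightUnitor, tensorIso_hom, Iso.refl_hom, id_tensorHom, Iso.symm_hom]

variable (𝕜) in
/-- The functor `Ĉ ⥤ C`, `m ↦ V^{(m)}`. -/
def reconFunctor : (θ.quadruple 𝕜).Recon ⥤ C := ofMatFunctor 𝕜 S.V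

instance : (θ.reconFunctor 𝕜).Faithful := inferInstanceAs (ofMatFunctor 𝕜 S.V).Faithful
instance : (θ.reconFunctor 𝕜).Full := inferInstanceAs (ofMatFunctor 𝕜 S.V).Full
instance : (θ.reconFunctor 𝕜).EssSurj := inferInstanceAs (ofMatFunctor 𝕜 S.V).EssSurj
instance : (θ.reconFunctor 𝕜).IsEquivalence where
instance : (θ.reconFunctor 𝕜).Additive := inferInstanceAs (ofMatFunctor 𝕜 S.V).Additive
instance : (θ.reconFunctor 𝕜).Linear 𝕜 := inferInstanceAs ((ofMatFunctor 𝕜 S.V).Linear 𝕜)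

variable (𝕜) in
/-- The compatibility of `m ↦ V^{(m)}` with the tensor products and the constraints. -/
def inducingData : @Monoidal.InducingFunctorData C _ _ (θ.quadruple 𝕜).Recon _
    (θ.quadruple 𝕜).tensorStruct (θ.reconFunctor 𝕜) :=
  letI := (θ.quadruple 𝕜).tensorStruct
  { μIso := θ.total 𝕜
    whiskerLeft_eq := fun X _ _ f => θ.ofMat_whiskerLeft X f
    whiskerRight_eq := fun f Y => θ.ofMat_whiskerRight f Y
    tensorHom_eq := fun f g => θ.ofMat_tensorHom f g
    εIso := unitIso S
    associator_eq := fun X Y Z => θ.ofMat_associator X Y Z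
    leftUnitor_eq := fun X => θ.ofMat_leftUnitor X _
    rightUnitor_eq := fun X => θ.ofMat_rightUnitor X _ }

/-- The monoidal axioms are equations between morphisms of `Ĉ`. Their images in `C` hold because
every structure morphism corresponds to that of `C` through `θ`, and faithfulness reflects them. The
induced category has the prescribed data definitionally, which gives the `rfl`. -/
theorem exists_monoidalCategory_tensorEquivalent :
    ∃ M : MonoidalCategory (θ.quadruple 𝕜).Recon,
      M.toMonoidalCategoryStruct = (θ.quadruple 𝕜).tensorStruct ∧
        TensorEquivalent 𝕜 (θ.quadruple 𝕜).Recon C :=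
  letI := (θ.quadruple 𝕜).tensorStruct
  ⟨Monoidal.induced (θ.reconFunctor 𝕜) (θ.inducingData 𝕜), rfl, θ.reconFunctor 𝕜,
    inferInstance, inferInstance, inferInstance,
    ⟨Monoidal.fromInducedMonoidal (θ.reconFunctor 𝕜) (θ.inducingData 𝕜)⟩⟩

end FusionIsos

end Data

/-! ### Existence of normalized isomorphisms `θ_{ij}` -/

section Existence

variable {C : Type u} [Category.{v} C] [Preadditive C]
  [HasFiniteBiproducts C] [HasBinaryBiproducts C]
  [MonoidalCategory C] [MonoidalPreadditive C] [IsKrullSchmidt C]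
  {n : ℕ} (S : IndecReps C n)

theorem greenBasis_c (i j : Fin (n + 1)) : (greenBasis S).c i j = mult S (S.V i ⊗ S.V j) := by
  funext k
  rw [ZPlusBasis.c, greenBasis_basis, greenBasis_basis, cls_mul]
  exact (congrArg Int.toNat (greenEquiv_repr S _ k)).trans (Int.toNat_natCast _)

theorem nonempty_iso_powObj_c (i j : Fin (n + 1)) :
    Nonempty (S.V i ⊗ S.V j ≅ powObj S.V ((greenBasis S).c i j)) :=
  greenBasis_c S i j ▸ nonempty_iso_powObj S (S.V i ⊗ S.V j)

theorem exists_iso_hom_eq_ι (V : Fin (n + 1) → C) {m : Fin (n + 1) → ℕ} {i : Fin (n + 1)}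
    (h : m = unitVec i) (h' : 0 < m i) :
    ∃ e : V i ≅ powObj V m, e.hom = biproduct.ι (fun p : Idx m => V p.1) ⟨i, ⟨0, h'⟩⟩ := by
  subst h
  exact ⟨powSingle V i, rfl⟩

/-- After substituting `W = 𝟙_ C` this is `λ_𝟙 = ρ_𝟙`. It makes the left and right normalizations of
`θ_{00}` compatible. -/
theorem eqToHom_whiskerRight_leftUnitor {W : C} (h : W = 𝟙_ C) :
    eqToHom h ▷ W ≫ (λ_ W).hom = W ◁ eqToHom h ≫ (ρ_ W).hom := by
  subst h
  simp [unitors_equal]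

/-- Both normalizations are stated as implications for one isomorphism, so that a single choice over
all pairs `(i, j)` satisfies them simultaneously. Away from `i = 0` and `j = 0` they are vacuous. -/
theorem exists_fusionIso (i j : Fin (n + 1)) :
    ∃ e : S.V i ⊗ S.V j ≅ powObj S.V ((greenBasis S).c i j),
      (∀ h : i = 0, e.hom = eqToHom (h ▸ S.V_zero) ▷ S.V j ≫ (λ_ (S.V j)).hom ≫
        biproduct.ι (fun p : Idx ((greenBasis S).c i j) => S.V p.1)
          ⟨j, ⟨0, by rw [h, (greenBasis S).c_zero_left]; simp⟩⟩) ∧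
      (∀ h : j = 0, e.hom = S.V i ◁ eqToHom (h ▸ S.V_zero) ≫ (ρ_ (S.V i)).hom ≫
        biproduct.ι (fun p : Idx ((greenBasis S).c i j) => S.V p.1)
          ⟨i, ⟨0, by rw [h, (greenBasis S).c_zero_right]; simp⟩⟩) := by
  by_cases hi : i = 0
  · subst hi
    obtain ⟨e, he⟩ := exists_iso_hom_eq_ι S.V ((greenBasis S).c_zero_left j)
      (by rw [(greenBasis S).c_zero_left]; simp)
    refine ⟨whiskerRightIso (eqToIso S.V_zero) _ ≪≫ λ_ _ ≪≫ e, fun _ => ?_, fun hj => ?_⟩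
    · rw [← he]
      rfl
    -- The pair `(0, 0)`: the isomorphism built from `λ` must also satisfy the right normalization.
    · subst hj
      rw [← he, ← Category.assoc, ← eqToHom_whiskerRight_leftUnitor, Category.assoc]
      rfl
  · by_cases hj : j = 0
    · subst hj
      obtain ⟨e, he⟩ := exists_iso_hom_eq_ι S.V ((greenBasis S).c_zero_right i)
        (by rw [(greenBasis S).c_zero_right]; simp)
      refine ⟨whiskerLeftIso _ (eqToIso S.V_zero) ≪≫ ρ_ _ ≪≫ e, fun h => absurd h hi, fun _ => ?_⟩
      rw [← he]
      rfl
    · exact ⟨(nonempty_iso_powObj_c S i j).some, fun h => absurd h hi, fun h => absurd h hj⟩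

theorem nonempty_fusionIsos : Nonempty (FusionIsos S) := by
  choose e h₁ h₂ using exists_fusionIso S
  exact ⟨⟨e, fun i => h₁ 0 i rfl, fun i => h₂ i 0 rfl⟩⟩

end Existence

/-- Structure constants are the coordinates of products of basis elements, and these are carried
along by `f`. -/
theorem ZPlusBasis.c_eq_of_ringEquiv {R R' : Type*} [Ring R] [Ring R'] {n : ℕ}
    (r : ZPlusBasis R n) (r' : ZPlusBasis R' n) (f : R ≃+* R')
    (hf : ∀ i, f (r.basis i) = r'.basis i) : r.c = r'.c := by
  funext i j k
  have h : r'.basis i * r'.basis j = ∑ k, (r.c i j k : ℤ) • r'.basis k := by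
    rw [← hf, ← hf, ← map_mul, r.mul_eq, map_sum]
    simp only [map_zsmul, hf]
  rw [ZPlusBasis.c.eq_def r' i j k, h, r'.basis.repr_sum_self, Int.toNat_natCast]

theorem Matches.apply_eq {A A' : Type*} {n : ℕ} {δ : A → A'} {s m : Fin (n + 1) → ℕ}
    {X : Matrix (Idx s) (Idx m) A} {Y : Matrix (Idx s) (Idx m) A'} (h : Matches δ X Y)
    (p : Idx s) (q : Idx m) : δ (X p q) = Y p q :=
  h.2.2 p.1 q.1 p.2 q.2 p.2.2 p.2.2 q.2.2 q.2.2

/-! ### Application of `δ` to matrix entries -/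

section BaseChange

variable {𝕜 A A' : Type*} [Field 𝕜] [Ring A] [Algebra 𝕜 A] [Ring A'] [Algebra 𝕜 A'] {n : ℕ}
  {E : IdemFamily 𝕜 A n} {E' : IdemFamily 𝕜 A' n}

/-- Application of an algebra isomorphism respecting the idempotents to all matrix entries. -/
def Hat.mapFunctor (δ : A ≃ₐ[𝕜] A') (hδ : ∀ i, δ (E.e i) = E'.e i) : Hat E ⥤ Hat E' where
  obj m := ⟨m.mult⟩
  map X := ⟨fun p q => δ (Hat.mat X p q), fun p q => by
    rw [← hδ, ← hδ, ← map_mul, ← map_mul, Hat.left_mat, Hat.mat_right]⟩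
  map_id m := Hat.hom_ext fun p q => by
    change δ (Hat.mat (𝟙 m) p q) = Hat.mat (𝟙 (Hat.mk m.mult : Hat E')) p q
    rw [Hat.mat_id, Hat.mat_id]
    by_cases h : p = q
    · subst h
      simp [hδ]
    · rw [Matrix.diagonal_apply_ne _ h, Matrix.diagonal_apply_ne _ h, map_zero]
  map_comp X Y := Hat.hom_ext fun p q => by
    change δ (Hat.mat (X ≫ Y) p q) = _
    rw [Hat.mat_comp, Hat.mat_comp, Matrix.mul_apply, Matrix.mul_apply, map_sum]
    exact Finset.sum_congr rfl fun r _ => map_mul δ _ _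

variable (δ : A ≃ₐ[𝕜] A') (hδ : ∀ i, δ (E.e i) = E'.e i)

instance : (Hat.mapFunctor δ hδ).Additive where
  map_add {_ _ X Y} := Hat.hom_ext fun p q => map_add δ (Hat.mat X p q) (Hat.mat Y p q)

instance : (Hat.mapFunctor δ hδ).Linear 𝕜 where
  map_smul X a := Hat.hom_ext fun p q => map_smul δ a (Hat.mat X p q)

instance : (Hat.mapFunctor δ hδ).Faithful where
  map_injective h := Hat.hom_ext fun p q =>
    δ.injective (congrFun (congrFun (congrArg Hat.mat h) p) q)

instance : (Hat.mapFunctor δ hδ).Full where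
  map_surjective {m s} Y := ⟨⟨fun p q => δ.symm (Hat.mat Y p q), fun p q => by
      apply δ.injective
      rw [map_mul, map_mul, hδ, hδ, δ.apply_symm_apply]
      exact Y.2 p q⟩,
    Hat.hom_ext fun p q => δ.apply_symm_apply (Hat.mat Y p q)⟩

instance : (Hat.mapFunctor δ hδ).EssSurj where
  mem_essImage m := ⟨⟨m.mult⟩, ⟨Iso.refl _⟩⟩

instance : (Hat.mapFunctor δ hδ).IsEquivalence where

theorem Hat.mapFunctor_map_ins (m : Hat E) (p : Idx m.mult) :
    (Hat.mapFunctor δ hδ).map (Hat.ins m p) = Hat.ins ((Hat.mapFunctor δ hδ).obj m) p := by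
  refine Hat.hom_ext fun (p' : Idx m.mult) (w : Idx (unitVec p.1)) => ?_
  change δ (Hat.mat (Hat.ins m p) p' w) = Hat.mat (Hat.ins (⟨m.mult⟩ : Hat E') p) p' w
  rw [Hat.mat_ins, Hat.mat_ins]
  split_ifs
  · exact hδ _
  · exact map_zero δ

theorem Hat.mapFunctor_map_prj (m : Hat E) (p : Idx m.mult) :
    (Hat.mapFunctor δ hδ).map (Hat.prj m p) = Hat.prj ((Hat.mapFunctor δ hδ).obj m) p := by
  refine Hat.hom_ext fun (w : Idx (unitVec p.1)) (p' : Idx m.mult) => ?_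
  change δ (Hat.mat (Hat.prj m p) w p') = Hat.mat (Hat.prj (⟨m.mult⟩ : Hat E') p) w p'
  rw [Hat.mat_prj, Hat.mat_prj]
  split_ifs
  · exact hδ _
  · exact map_zero δ

variable {c c' : Fin (n + 1) → Fin (n + 1) → Fin (n + 1) → ℕ}

theorem TensorMap.tensorHom_eqToHom_id (φ : TensorMap E c) {m m' : Hat E} (h : m = m') (s : Hat E) :
    φ.tensorHom (eqToHom h) (𝟙 s) = eqToHom (congrArg (fun m => Hat.tensor c m s) h) := by
  subst h
  exact φ.tensorHom_id m s

theorem TensorMap.tensorHom_id_eqToHom (φ : TensorMap E c) {s s' : Hat E} (m : Hat E) (h : s = s') :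
    φ.tensorHom (𝟙 m) (eqToHom h) = eqToHom (congrArg (fun s => Hat.tensor c m s) h) := by
  subst h
  exact φ.tensorHom_id m s

/-- The sum `∑ (X_p ⊗̂ (X_q ⊗̂ X_r)) a_{ijl} ((Y_p ⊗̂ Y_q) ⊗̂ Y_r)`. -/
def TensorMap.assocSum (φ : TensorMap E c)
    (a : ∀ i j l : Fin (n + 1),
      Hat.tensor c (Hat.tensor c (Hat.single E i) (Hat.single E j)) (Hat.single E l) ⟶
        Hat.tensor c (Hat.single E i) (Hat.tensor c (Hat.single E j) (Hat.single E l)))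
    (m s t : Hat E) :
    Hat.tensor c (Hat.tensor c m s) t ⟶ Hat.tensor c m (Hat.tensor c s t) :=
  ∑ p : Idx m.mult, ∑ q : Idx s.mult, ∑ r : Idx t.mult,
    φ.tensorHom (φ.tensorHom (Hat.prj m p) (Hat.prj s q)) (Hat.prj t r) ≫
      a p.1 q.1 r.1 ≫ φ.tensorHom (Hat.ins m p) (φ.tensorHom (Hat.ins s q) (Hat.ins t r))

/-- Here `c` and `c'` are independent variables, so the equation `hc` can be substituted and the two
objects coincide definitionally. The structure constants of two given quadruples are only
propositionally equal, which explains the `eqToHom` in the statements that follow. -/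
theorem Hat.mapFunctor_obj_tensor (hc : c = c') (m s : Hat E) :
    Hat.tensor c' ((Hat.mapFunctor δ hδ).obj m) ((Hat.mapFunctor δ hδ).obj s) =
      (Hat.mapFunctor δ hδ).obj (Hat.tensor c m s) := by
  subst hc
  rfl

/-- Concatenation depends only on types and structure constants, not on entries. Entry by entry, the
claim is that `δ` carries `φ` to `φ'`. -/
theorem Hat.tensorHom_mapFunctor_map (hc : c = c') {φ : TensorMap E c} {φ' : TensorMap E' c'}
    (hφ : ∀ (x : A ⊗[𝕜] A) (u w : Fin (n + 1) × Fin (n + 1)),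
      Matches δ ((φ.toAlgHom x).block u w)
        ((φ'.toAlgHom (Algebra.TensorProduct.congr δ δ x)).block u w))
    {m s m' s' : Hat E} (X : m ⟶ m') (Y : s ⟶ s') :
    φ'.tensorHom ((Hat.mapFunctor δ hδ).map X) ((Hat.mapFunctor δ hδ).map Y) ≫
        eqToHom (Hat.mapFunctor_obj_tensor δ hδ hc m' s') =
      eqToHom (Hat.mapFunctor_obj_tensor δ hδ hc m s) ≫
        (Hat.mapFunctor δ hδ).map (φ.tensorHom X Y) := by
  subst hc
  -- After the substitution both `eqToHom` are identities.
  refine (Category.comp_id _).trans (Eq.trans ?_ (Category.id_comp _).symm)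
  refine Hat.hom_ext fun P Q => ?_
  let x := splitIdx c m'.mult s'.mult P
  let y := splitIdx c m.mult s.mult Q
  exact ((hφ (Hat.mat X x.1.1 y.1.1 ⊗ₜ Hat.mat Y x.1.2 y.1.2) (x.1.1.1, x.1.2.1)
    (y.1.1.1, y.1.2.1)).apply_eq x.2 y.2).symm

theorem Hat.mapFunctor_obj_tensor_left (hc : c = c') (m s t : Hat E) :
    Hat.tensor c' (Hat.tensor c' ((Hat.mapFunctor δ hδ).obj m) ((Hat.mapFunctor δ hδ).obj s))
        ((Hat.mapFunctor δ hδ).obj t) =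
      (Hat.mapFunctor δ hδ).obj (Hat.tensor c (Hat.tensor c m s) t) := by
  subst hc
  rfl

theorem Hat.mapFunctor_obj_tensor_right (hc : c = c') (m s t : Hat E) :
    Hat.tensor c' ((Hat.mapFunctor δ hδ).obj m) (Hat.tensor c' ((Hat.mapFunctor δ hδ).obj s)
        ((Hat.mapFunctor δ hδ).obj t)) =
      (Hat.mapFunctor δ hδ).obj (Hat.tensor c m (Hat.tensor c s t)) := by
  subst hc
  rfl

/-- The functor preserves sums, composites, insertions, projections and `⊗̂`, and carries `a_{ijl}`
to `a'_{ijl}`. Hence it preserves each term of the sum. -/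
theorem Hat.mapFunctor_map_assocSum (hc : c = c') {φ : TensorMap E c} {φ' : TensorMap E' c'}
    (hφ : ∀ (x : A ⊗[𝕜] A) (u w : Fin (n + 1) × Fin (n + 1)),
      Matches δ ((φ.toAlgHom x).block u w)
        ((φ'.toAlgHom (Algebra.TensorProduct.congr δ δ x)).block u w))
    {a : ∀ i j l : Fin (n + 1),
      Hat.tensor c (Hat.tensor c (Hat.single E i) (Hat.single E j)) (Hat.single E l) ⟶
        Hat.tensor c (Hat.single E i) (Hat.tensor c (Hat.single E j) (Hat.single E l))}
    {a' : ∀ i j l : Fin (n + 1),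
      Hat.tensor c' (Hat.tensor c' (Hat.single E' i) (Hat.single E' j)) (Hat.single E' l) ⟶
        Hat.tensor c' (Hat.single E' i) (Hat.tensor c' (Hat.single E' j) (Hat.single E' l))}
    (ha : ∀ i j l, Matches δ (Hat.mat (a i j l)) (Hat.mat (a' i j l))) (m s t : Hat E) :
    eqToHom (Hat.mapFunctor_obj_tensor_left δ hδ hc m s t) ≫
        (Hat.mapFunctor δ hδ).map (φ.assocSum a m s t) =
      φ'.assocSum a' ((Hat.mapFunctor δ hδ).obj m) ((Hat.mapFunctor δ hδ).obj s)
          ((Hat.mapFunctor δ hδ).obj t) ≫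
        eqToHom (Hat.mapFunctor_obj_tensor_right δ hδ hc m s t) := by
  subst hc
  refine (Category.id_comp _).trans (Eq.trans ?_ (Category.comp_id _).symm)
  have hT {m s m' s' : Hat E} (X : m ⟶ m') (Y : s ⟶ s') :
      (Hat.mapFunctor δ hδ).map (φ.tensorHom X Y) =
        φ'.tensorHom ((Hat.mapFunctor δ hδ).map X) ((Hat.mapFunctor δ hδ).map Y) :=
    (Category.id_comp _).symm.trans
      ((Hat.tensorHom_mapFunctor_map δ hδ rfl hφ X Y).symm.trans (Category.comp_id _))
  have hA (i j l : Fin (n + 1)) : (Hat.mapFunctor δ hδ).map (a i j l) = a' i j l :=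
    Hat.hom_ext fun P Q => (ha i j l).apply_eq P Q
  rw [TensorMap.assocSum, TensorMap.assocSum, Functor.map_sum]
  refine Finset.sum_congr rfl fun p _ => ?_
  rw [Functor.map_sum]
  refine Finset.sum_congr rfl fun q _ => ?_
  rw [Functor.map_sum]
  refine Finset.sum_congr rfl fun r _ => ?_
  rw [Functor.map_comp, Functor.map_comp, hA, hT, hT, hT, hT, Hat.mapFunctor_map_ins,
    Hat.mapFunctor_map_ins, Hat.mapFunctor_map_ins, Hat.mapFunctor_map_prj,
    Hat.mapFunctor_map_prj, Hat.mapFunctor_map_prj]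
  rfl

end BaseChange

/-! ### Symmetry and transitivity of tensor equivalence -/

section TensorEquivalent

variable {𝕜 : Type*} [Field 𝕜] {C : Type*} [Category* C] [Preadditive C] [Linear 𝕜 C]
    [MonoidalCategory C] {D : Type*} [Category* D] [Preadditive D] [Linear 𝕜 D]
    [MonoidalCategory D] {D' : Type*} [Category* D'] [Preadditive D'] [Linear 𝕜 D']
    [MonoidalCategory D']

/-- A quasi-inverse of a linear strong monoidal equivalence is again linear, and it inherits a
monoidal structure through the adjunction. -/
theorem TensorEquivalent.symm (h : TensorEquivalent 𝕜 C D) : TensorEquivalent 𝕜 D C := by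
  obtain ⟨F, _, _, _, ⟨_⟩⟩ := h
  have : F.asEquivalence.functor.Additive := inferInstanceAs F.Additive
  have : F.asEquivalence.functor.Linear 𝕜 := ‹F.Linear 𝕜›
  let _ : F.asEquivalence.functor.Monoidal := inferInstanceAs F.Monoidal
  exact ⟨F.asEquivalence.inverse, inferInstance, inferInstance, inferInstance,
    ⟨F.asEquivalence.inverseMonoidal⟩⟩

theorem TensorEquivalent.trans (h : TensorEquivalent 𝕜 C D) (h' : TensorEquivalent 𝕜 D D') :
    TensorEquivalent 𝕜 C D' := by
  obtain ⟨F, _, _, _, ⟨_⟩⟩ := h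
  obtain ⟨G, _, _, _, ⟨_⟩⟩ := h'
  exact ⟨F ⋙ G, inferInstance, inferInstance, inferInstance, ⟨inferInstance⟩⟩

end TensorEquivalent

/-! ### Isomorphic quadruples give tensor equivalent categories -/

section QuadrupleIso

variable {𝕜 R A R' A' : Type*} [Field 𝕜] [Ring R] [Ring A] [Algebra 𝕜 A] [Ring R'] [Ring A']
  [Algebra 𝕜 A'] {n : ℕ} {Q : Quadruple 𝕜 R A n} {Q' : Quadruple 𝕜 R' A' n}

theorem Quadruple.assoc_hom (Q : Quadruple 𝕜 R A n) (m s t : Hat Q.idem) :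
    (Q.assoc m s t).hom = Q.φ.assocSum (fun i j l => (Q.a i j l).hom) m s t := rfl

namespace QuadrupleIso

theorem c_eq (f : QuadrupleIso Q Q') : Q.basis.c = Q'.basis.c :=
  Q.basis.c_eq_of_ringEquiv Q'.basis f.ringEquiv f.map_basis

variable (f : QuadrupleIso Q Q')

/-- The functor that applies the algebra isomorphism to matrix entries. -/
abbrev functor : Hat Q.idem ⥤ Hat Q'.idem := Hat.mapFunctor f.algEquiv f.map_idem

theorem obj_tensor (m s : Hat Q.idem) :
    Hat.tensor Q'.basis.c (f.functor.obj m) (f.functor.obj s) =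
      f.functor.obj (Hat.tensor Q.basis.c m s) :=
  Hat.mapFunctor_obj_tensor f.algEquiv f.map_idem f.c_eq m s

theorem tensorHom_map {m s m' s' : Hat Q.idem} (X : m ⟶ m') (Y : s ⟶ s') :
    Q'.φ.tensorHom (f.functor.map X) (f.functor.map Y) ≫ eqToHom (f.obj_tensor m' s') =
      eqToHom (f.obj_tensor m s) ≫ f.functor.map (Q.φ.tensorHom X Y) :=
  Hat.tensorHom_mapFunctor_map f.algEquiv f.map_idem f.c_eq f.map_φ X Y

theorem tensorHom_map_id {m m' : Hat Q.idem} (X : m ⟶ m') (s : Hat Q.idem) :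
    Q'.φ.tensorHom (f.functor.map X) (𝟙 (f.functor.obj s)) ≫ eqToHom (f.obj_tensor m' s) =
      eqToHom (f.obj_tensor m s) ≫ f.functor.map (Q.φ.tensorHom X (𝟙 s)) := by
  rw [← f.tensorHom_map, f.functor.map_id]

theorem tensorHom_id_map (m : Hat Q.idem) {s s' : Hat Q.idem} (Y : s ⟶ s') :
    Q'.φ.tensorHom (𝟙 (f.functor.obj m)) (f.functor.map Y) ≫ eqToHom (f.obj_tensor m s') =
      eqToHom (f.obj_tensor m s) ≫ f.functor.map (Q.φ.tensorHom (𝟙 m) Y) := by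
  rw [← f.tensorHom_map, f.functor.map_id]

/-- The associativity axiom for a monoidal functor whose tensor comparison maps are equalities of
objects. On each side these merge into one `eqToHom`, which leaves `Hat.mapFunctor_map_assocSum`. -/
theorem map_assoc (m s t : Hat Q.idem) :
    Q'.φ.tensorHom (eqToHom (f.obj_tensor m s)) (𝟙 (f.functor.obj t)) ≫
        eqToHom (f.obj_tensor (Hat.tensor Q.basis.c m s) t) ≫
          f.functor.map (Q.assoc m s t).hom =
      (Q'.assoc (f.functor.obj m) (f.functor.obj s) (f.functor.obj t)).hom ≫
        Q'.φ.tensorHom (𝟙 (f.functor.obj m)) (eqToHom (f.obj_tensor s t)) ≫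
          eqToHom (f.obj_tensor m (Hat.tensor Q.basis.c s t)) := by
  rw [TensorMap.tensorHom_eqToHom_id, TensorMap.tensorHom_id_eqToHom, eqToHom_trans_assoc,
    eqToHom_trans, Q.assoc_hom, Q'.assoc_hom]
  exact Hat.mapFunctor_map_assocSum f.algEquiv f.map_idem f.c_eq f.map_φ f.map_a m s t

/-- All arrows are identities or come from equalities of objects, so both sides are the same
`eqToHom`. -/
theorem map_leftUnitor (m : Hat Q.idem) (h : Hat.tensor Q.basis.c (Hat.single _ 0) m = m)
    (h' : Hat.tensor Q'.basis.c (f.functor.obj (Hat.single _ 0)) (f.functor.obj m) = f.functor.obj m) :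
    (eqToIso h').hom = Q'.φ.tensorHom (𝟙 (f.functor.obj (Hat.single _ 0))) (𝟙 (f.functor.obj m)) ≫
      eqToHom (f.obj_tensor (Hat.single _ 0) m) ≫ f.functor.map (eqToIso h).hom := by
  rw [TensorMap.tensorHom_id, eqToIso.hom, eqToIso.hom, eqToHom_map, eqToHom_trans, Category.id_comp]

theorem map_rightUnitor (m : Hat Q.idem) (h : Hat.tensor Q.basis.c m (Hat.single _ 0) = m)
    (h' : Hat.tensor Q'.basis.c (f.functor.obj m) (f.functor.obj (Hat.single _ 0)) = f.functor.obj m) :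
    (eqToIso h').hom = Q'.φ.tensorHom (𝟙 (f.functor.obj m)) (𝟙 (f.functor.obj (Hat.single _ 0))) ≫
      eqToHom (f.obj_tensor m (Hat.single _ 0)) ≫ f.functor.map (eqToIso h).hom := by
  rw [TensorMap.tensorHom_id, eqToIso.hom, eqToIso.hom, eqToHom_map, eqToHom_trans, Category.id_comp]

/-- The functor between the reconstructed categories given by an isomorphism of quadruples. -/
def reconFunctor : Q.Recon ⥤ Q'.Recon := f.functor

/-- The functor given by an isomorphism of quadruples is monoidal. -/
def coreMonoidal [M : MonoidalCategory Q.Recon] [M' : MonoidalCategory Q'.Recon]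
    (hM : M.toMonoidalCategoryStruct = Q.tensorStruct)
    (hM' : M'.toMonoidalCategoryStruct = Q'.tensorStruct) : f.reconFunctor.CoreMonoidal := by
  -- Only the data of the monoidal structures are prescribed, by equations. Splitting off the axioms
  -- turns the data into variables that these equations eliminate.
  obtain @⟨M, _⟩ := M
  obtain @⟨M', _⟩ := M'
  dsimp only at hM hM'
  subst hM hM'
  -- The functor is the identity on multiplicity vectors, so it fixes the unit `e_0`, and the tensor
  -- comparison is the equality `f.obj_tensor`.
  exact @Functor.CoreMonoidal.mk _ _ (_) _ _ (_) _ (Iso.refl (Hat.single Q'.idem 0))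
    (fun m s => eqToIso (f.obj_tensor m s)) (fun X s => f.tensorHom_map_id X s)
    (fun m Y => f.tensorHom_id_map m Y) (fun m s t => f.map_assoc m s t)
    (fun m => f.map_leftUnitor m _ _) (fun m => f.map_rightUnitor m _ _)

theorem tensorEquivalent (f : QuadrupleIso Q Q') [M : MonoidalCategory Q.Recon] [M' : MonoidalCategory Q'.Recon]
    (hM : M.toMonoidalCategoryStruct = Q.tensorStruct)
    (hM' : M'.toMonoidalCategoryStruct = Q'.tensorStruct) :
    TensorEquivalent 𝕜 Q.Recon Q'.Recon :=
  ⟨f.reconFunctor, inferInstanceAs f.functor.Additive, inferInstanceAs (f.functor.Linear 𝕜),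
    inferInstanceAs f.functor.IsEquivalence, ⟨(f.coreMonoidal hM hM').toMonoidal⟩⟩

end QuadrupleIso

end QuadrupleIso

end TensorRecon

end

/-! ### The reconstruction theorem -/

theorem mainTheorem1 {𝕜 : Type*} [Field 𝕜] [IsAlgClosed 𝕜]
    {C : Type u} [Category.{v} C] [Abelian C] [Linear 𝕜 C] [MonoidalCategory C]
    [MonoidalPreadditive C] [MonoidalLinear 𝕜 C] [IsKrullSchmidt C]
    (hfin : ∀ X Y : C, FiniteDimensional 𝕜 (X ⟶ Y)) (hunit : Simple (𝟙_ C))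
    {n : ℕ} (S : IndecReps C n) :
    Nonempty (FusionIsos S) ∧
    ∀ θ : FusionIsos S,
      (∃ M : MonoidalCategory (θ.quadruple 𝕜).Recon,
        M.toMonoidalCategoryStruct = (θ.quadruple 𝕜).tensorStruct ∧
          TensorEquivalent 𝕜 (θ.quadruple 𝕜).Recon C) ∧
      ∀ (C' : Type u') [Category.{v'} C'] [Abelian C'] [Linear 𝕜 C'] [MonoidalCategory C']
        [MonoidalPreadditive C'] [MonoidalLinear 𝕜 C'] [IsKrullSchmidt C'],
        (∀ X Y : C', FiniteDimensional 𝕜 (X ⟶ Y)) → Simple (𝟙_ C') →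
        ∀ (S' : IndecReps C' n) (θ' : FusionIsos S'),
          Nonempty (QuadrupleIso (θ.quadruple 𝕜) (θ'.quadruple 𝕜)) → TensorEquivalent 𝕜 C C' := by
  refine ⟨nonempty_fusionIsos S, fun θ => ⟨θ.exists_monoidalCategory_tensorEquivalent, ?_⟩⟩
  intro C' _ _ _ _ _ _ _ _ _ S' θ' ⟨f⟩
  obtain ⟨M, hM, h⟩ := θ.exists_monoidalCategory_tensorEquivalent (𝕜 := 𝕜)
  obtain ⟨M', hM', h'⟩ := θ'.exists_monoidalCategory_tensorEquivalent (𝕜 := 𝕜)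
  -- The chain `C ≃ Ĉ ≃ Ĉ' ≃ C'`, with the middle step given by the isomorphism of quadruples.
  exact h.symm.trans ((f.tensorEquivalent hM hM').trans h')
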